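/- Let $C$ be a field of characteristic zero and $F=C(x)$. Let $\sigma_y,\sigma_z$ be the shifts $y\mapsto y+1$, $z\mapsto z+1$ on $F(y,z)$. Call $f\in F(y,z)$ *summable* if $f=\sigma_y(g)-g+\sigma_z(h)-h$ for some $g,h\in F(y,z)$. Call $p,q\in F[y,z]$ *shift equivalent* if $p=\sigma_y^{\lambda}\sigma_z^{\mu}(q)$ for some $\lambda,\mu\in\mathbb Z$. A polynomial is *monic* if its highest term for the pure lexicographic order $y\prec z$ has coefficient one, and $\deg_y(0)=\deg_z(0)=-\infty$. A polynomial $d$ is *integer linear of $(\alpha,\beta)$-type* if $d=p(\alpha y+\beta z)$ with $p\in F[Z]$ and coprime integers $\alpha,\beta$, $\beta\ge 0$. A fraction $a/(b\,d^j)$ with $a,d\in F[y,z]$, $0\neq b\in F[y]$, $j\ge 1$ is a *remainder fraction* if $\deg_z a<\deg_z d$; $d$ is monic, irreducible and of positive degree in $z$; and, whenever $d$ is integer linear of $(\alpha,\beta)$-type, (i) $a=\sum_{i=0}^{\deg_z a}\hat a_i(\alpha y+\beta z)^i$ with $\hat a_i\in F[y]$, $\deg_y\hat a_i<\deg_y b$,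 and (ii) $\gcd(b,\sigma_y^{\beta\ell}(b))=1$ for all nonzero $\ell\in\mathbb Z$. Let $r\in F(y,z)$ be nonzero with a remainder form $$r=\sum_{i=1}^m\sum_{j=1}^{n_i}\frac{a_{ij}}{b_{ij}d_i^j},$$ where each $a_{ij}/(b_{ij}d_i^j)$ is a remainder fraction, each $d_i$ is a monic irreducible factor, of positive degree in $z$, of the denominator of $r$, and $d_i,d_{i'}$ are not shift equivalent for $i\ne i'$. Assume that the form is reduced: $\gcd(a_{ij},b_{ij}d_i^j)=1$ whenever $a_{ij}\neq0$, $b_{ij}$ is constant whenever $a_{ij}=0$, and $a_{i,n_i}\ne 0$. Let $r'\in F(y,z)$ be such that $r'-r$ is summable, and write $$r'=p'+\sum_{i=1}^{m'}\sum_{j=1}^{n'_i}\frac{a'_{ij}}{b'_{ij}{d'_i}^{j}},$$ with $p'\in F(y)[z]$, $a'_{ij},d'_i\in F[y,z]$, $0\ne b'_{ij}\in F[y]$, $\deg_z a'_{ij}<\deg_z d'_i$, and each $d'_i$ a monic irreducible factor, of positive degree in $z$, of the denominator of $r'$. For $1\le i\le m$ let $\Lambda_i$ be the set of $i'\in\{1,\dots,m'\}$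 such that $d'_{i'}$ is shift equivalent to $d_i$. Then 1. $\Lambda_i\neq\emptyset$ for every $1\le i\le m$; 2. $m\le m'$; 3. $n_i\le\max_{i'\in\Lambda_i}n'_{i'}$ for every $1\le i\le m$; 4. $\deg_y b_{ij}\le\sum_{i'\in\Lambda_i,\ j\le n'_{i'}}\deg_y b'_{i'j}$ for every $1\le i\le m$, $1\le j\le n_i$; 5. the degree in $z$ of the denominator of $r$ (in lowest terms) is at most that of $r'$. -/

import Mathlib

noncomputable section

namespace Remainders

open Polynomial

/-- The ring `F[y,z]`, written as `F[y][z]`: the inner variable is `y`, the outer one is `z`.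
So `degree` / `natDegree` of an element is its degree in `z`, and a polynomial `b : F[X]`
in `y` alone sits in `F[y,z]` as `C b`. -/
abbrev PolyYZ (F : Type*) [Field F] : Type _ := Polynomial (Polynomial F)

/-- The field `F(y,z)` of rational functions. -/
abbrev RatYZ (F : Type*) [Field F] : Type _ := FractionRing (PolyYZ F)

variable {F : Type*} [Field F]

/-- The inclusion `F[y,z] → F(y,z)`. -/
abbrev toRat (p : PolyYZ F) : RatYZ F := algebraMap (PolyYZ F) (RatYZ F) p

/-- The shift operator `σ_y : y ↦ y + 1` on `F[y,z]`. -/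
def sigmaY : PolyYZ F ≃ₐ[F] PolyYZ F := Polynomial.mapAlgEquiv (algEquivAevalXAddC (1 : F))

/-- The shift operator `σ_z : z ↦ z + 1` on `F[y,z]`. -/
def sigmaZ : PolyYZ F ≃ₐ[F] PolyYZ F :=
  (algEquivAevalXAddC (1 : Polynomial F)).restrictScalars F

/-- The extension of an automorphism of `F[y,z]` to the field `F(y,z)`. -/
def ratExt (τ : PolyYZ F ≃ₐ[F] PolyYZ F) : RatYZ F ≃ₐ[F] RatYZ F :=
  IsFractionRing.algEquivOfAlgEquiv τ

/-- `f` is `(σ_y,σ_z)`-summable: `f = σ_y(g) - g + σ_z(h) - h` for some `g, h ∈ F(y,z)`. -/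
def IsSummable (f : RatYZ F) : Prop :=
  ∃ g h : RatYZ F, f = ratExt sigmaY g - g + (ratExt sigmaZ h - h)

/-- `p` is `τ`-free: `gcd(p, τ^ℓ(p)) = 1` for every nonzero integer `ℓ`. -/
def IsTauFree (τ : PolyYZ F ≃ₐ[F] PolyYZ F) (p : PolyYZ F) : Prop :=
  ∀ l : ℤ, l ≠ 0 → IsRelPrime p ((τ ^ l) p)

/-- `p` and `q` are `(y,z)`-shift equivalent: `p = σ_y^λ σ_z^μ (q)` for integers `λ, μ`. -/
def ShiftEquiv (p q : PolyYZ F) : Prop :=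
  ∃ l k : ℤ, p = (sigmaY ^ l) ((sigmaZ ^ k) q)

/-- The linear form `α y + β z`. -/
def linForm (α β : ℤ) : PolyYZ F := α • C X + β • X

/-- `d` is `(y,z)`-integer linear over `F` of `(α,β)`-type: `d = p(α y + β z)` for a univariate
polynomial `p` over `F`, with `α, β` coprime integers and `β ≥ 0`. -/
def IsIntegerLinear (α β : ℤ) (d : PolyYZ F) : Prop :=
  IsCoprime α β ∧ 0 ≤ β ∧ ∃ p : Polynomial F, d = aeval (linForm α β) p

/-- `d` is monic with respect to the pure lexicographic order `y ≺ z`, irreducible, and of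
positive degree in `z`. -/
def IsMonicIrred (d : PolyYZ F) : Prop :=
  d.leadingCoeff.leadingCoeff = 1 ∧ Irreducible d ∧ 0 < d.degree

/-- The fraction `a / (b d^j)`, with `a, d ∈ F[y,z]` and `b ∈ F[y]`. -/
def simpleFrac (a : PolyYZ F) (b : Polynomial F) (d : PolyYZ F) (j : ℕ) : RatYZ F :=
  toRat a / (toRat (C b) * toRat d ^ j)

/-- `a / (b d^j)` is a remainder fraction. -/
structure IsRemainderFraction (a : PolyYZ F) (b : Polynomial F) (d : PolyYZ F) (j : ℕ) :
    Prop where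
  pos : 0 < j
  den_ne_zero : b ≠ 0
  degree_lt : a.degree < d.degree
  monicIrred : IsMonicIrred d
  /-- If `d` is integer linear of `(α,β)`-type, then `a = ∑_{i = 0}^{deg_z a} a_i (α y + β z)^i`
  with `a_i ∈ F[y]` and `deg_y a_i < deg_y b`. -/
  numerator : ∀ α β : ℤ, IsIntegerLinear α β d →
    ∃ c : ℕ → Polynomial F,
      a = ∑ i ∈ Finset.range (a.natDegree + 1), C (c i) * linForm α β ^ i ∧
      ∀ i ∈ Finset.range (a.natDegree + 1), (c i).degree < b.degree
  /-- If `d` is integer linear of `(α,β)`-type, then `b` is `σ_y^β`-free. -/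
  denominator : ∀ α β : ℤ, IsIntegerLinear α β d → IsTauFree (sigmaY ^ β) (C b)

/-- The denominator of a rational function (in lowest terms, determined up to a unit). -/
def denom (r : RatYZ F) : PolyYZ F := IsFractionRing.den (PolyYZ F) r

/-- `r = ∑_{i=1}^m ∑_{j=1}^{n_i} a_{ij} / (b_{ij} d_i^j)` is a remainder form of `r`.
A rational function is a `(σ_y,σ_z)`-remainder precisely if it has a remainder form. -/
structure IsRemainderForm (r : RatYZ F) (m : ℕ) (n : Fin m → ℕ) (a : Fin m → ℕ → PolyYZ F)
    (b : Fin m → ℕ → Polynomial F) (d : Fin m → PolyYZ F) : Prop where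
  eq_sum : r = ∑ i, ∑ j ∈ Finset.Icc 1 (n i), simpleFrac (a i j) (b i j) (d i) j
  frac : ∀ i, ∀ j ∈ Finset.Icc 1 (n i), IsRemainderFraction (a i j) (b i j) (d i) j
  monicIrred : ∀ i, IsMonicIrred (d i)
  dvd_denom : ∀ i, d i ∣ denom r
  inequiv : ∀ i k, i ≠ k → ¬ ShiftEquiv (d i) (d k)

/-- The fractions `a_{ij} / (b_{ij} d_i^j)` are in lowest terms (the zero fraction having a
constant `b_{ij}`), and the fraction of the highest power of each `d_i` is really there. -/
structure IsReducedForm (m : ℕ) (n : Fin m → ℕ) (a : Fin m → ℕ → PolyYZ F)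
    (b : Fin m → ℕ → Polynomial F) (d : Fin m → PolyYZ F) : Prop where
  relPrime : ∀ i, ∀ j ∈ Finset.Icc 1 (n i), a i j ≠ 0 → IsRelPrime (a i j) (C (b i j) * d i ^ j)
  isUnit_of_zero : ∀ i, ∀ j ∈ Finset.Icc 1 (n i), a i j = 0 → IsUnit (b i j)
  top_ne_zero : ∀ i, 1 ≤ n i → a i (n i) ≠ 0

/-- `f` lies in the subring `F(y)[z]` of `F(y,z)`. -/
def IsPolyInZ (f : RatYZ F) : Prop :=
  ∃ (u : PolyYZ F) (v : Polynomial F), v ≠ 0 ∧ f = toRat u / toRat (C v)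

/-- `r = p + ∑_{i=1}^m ∑_{j=1}^{n_i} a_{ij} / (b_{ij} d_i^j)` with `p ∈ F(y)[z]`,
`deg_z a_{ij} < deg_z d_i`, and each `d_i` a monic irreducible factor, of positive degree in `z`,
of the denominator of `r`. -/
structure IsPartialFractionForm (r p : RatYZ F) (m : ℕ) (n : Fin m → ℕ)
    (a : Fin m → ℕ → PolyYZ F) (b : Fin m → ℕ → Polynomial F) (d : Fin m → PolyYZ F) :
    Prop where
  eq_sum : r = p + ∑ i, ∑ j ∈ Finset.Icc 1 (n i), simpleFrac (a i j) (b i j) (d i) j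
  polyPart : IsPolyInZ p
  den_ne_zero : ∀ i, ∀ j ∈ Finset.Icc 1 (n i), b i j ≠ 0
  degree_lt : ∀ i, ∀ j ∈ Finset.Icc 1 (n i), (a i j).degree < (d i).degree
  monicIrred : ∀ i, IsMonicIrred (d i)
  dvd_denom : ∀ i, d i ∣ denom r

open Classical in
/-- The set of indices `i'` such that `d'_{i'} = σ_y^λ σ_z^μ (d)` for some integers `λ, μ`. -/
def shiftIdx {m' : ℕ} (d' : Fin m' → PolyYZ F) (d : PolyYZ F) : Finset (Fin m') :=
  Finset.univ.filter fun i' => ShiftEquiv (d' i') d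

end Remainders

end

/-! Expand a rational function at an irreducible `d` over `F(y)[z]`: it has a unique finite polar
part whose digit at `d ^ (-(j+1))` is a fraction `a / b` with `deg_z a < deg_z d` and `b` in `F[y]`.
The shifts permute these expansions along the orbit of `d`. Transport all digits of a fixed order
from the orbit back to `d` and add them. The result depends on the choice of transporting shifts
only up to elements `s v - v` with `s` in the stabilizer of `d`, so modulo a subgroup `W` containing
these it is an additive, shift-invariant residue (`OrbitExpansion.residue_map`). It therefore
vanishes on summable functions, and `r` and `r'` have equal residues.

For `r` the residue at `d i` is the single class of `a i j / b i j`, because the `d i` are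
inequivalent; for `r'` it is a sum of shifted fractions, with denominator of degree the sum of the
`deg_y b'` over the orbit. It remains to compare denominators modulo `W`. By `shift_stabilizer`
either the stabilizer is trivial, and `W = 0`, or `d` is integer linear of type `(α, β)` and the
stabilizer lies in the group generated by `τ = σ_y^β σ_z^(-α)`; then `W` is the image of `τ - 1`. In
that case freeness of `b` forces every prime power of `b` to recur, up to a shift, in the other
denominator (`exists_zpow_pow_dvd`, `natDegree_le_of_sub_eq_sub`), which gives the bound on `deg_y
b`. The same argument with zero on the other side makes `b` constant, and then the degree condition
on the numerator gives `a = 0`.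

Hence the nonzero top digit of `r` at `d i` forces a pole of order at least `n i` of `r'` at some
shift of `d i`. This yields the statements on `Λ_i`, on `m` and `m'`, on the `n i`, and on the
degrees of the denominators. -/

noncomputable section

namespace Remainders

open Polynomial

/-! ### Polar expansions and their invariant sums over an orbit -/

section

/-- A subring `O` of a field `L` with a uniformizer `π` and an additive complement `V` of `π O`
in `O`; every element of `L` then has a finite `π`-adic polar part with digits in `V`. -/
structure LocalExpansion (L : Type*) [Field L] where
  O : Subring L
  V : AddSubgroup L
  π : L
  π_ne_zero : π ≠ 0
  π_mem : π ∈ O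
  mem_O_of_mem_V : ∀ v ∈ V, v ∈ O
  eq_zero_of_mem_V : ∀ v ∈ V, ∀ o ∈ O, v = π * o → v = 0
  exists_split : ∀ f ∈ O, ∃ v ∈ V, ∃ o ∈ O, f = v + π * o
  exists_pow_mul_mem : ∀ f, ∃ N : ℕ, π ^ N * f ∈ O

namespace LocalExpansion

variable {L : Type*} [Field L] (P : LocalExpansion L)

/-- The element `o + ∑ j, c j / π ^ (j + 1)`. -/
def assemble : (ℕ →₀ P.V) × P.O →+ L :=
  (Finsupp.liftAddHom fun j => (AddMonoidHom.mulRight ((P.π ^ (j + 1))⁻¹)).comp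
    P.V.subtype).coprod P.O.subtype.toAddMonoidHom

theorem assemble_apply (c : ℕ →₀ P.V) (o : P.O) :
    P.assemble (c, o) = (c.sum fun j v => (v : L) * (P.π ^ (j + 1))⁻¹) + o := rfl

theorem assemble_single (j : ℕ) (v : P.V) (o : P.O) :
    P.assemble (Finsupp.single j v, o) = (v : L) * (P.π ^ (j + 1))⁻¹ + o := by
  rw [assemble_apply, Finsupp.sum_single_index (by simp)]

/-- Subtracting the digit of highest order lowers the pole order by one. Keeping track of the bound
`N` shows that no digit occurs beyond the pole order. -/
theorem exists_assemble_eq (N : ℕ) (f : L) (hf : P.π ^ N * f ∈ P.O) :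
    ∃ c o, P.assemble (c, o) = f ∧ ∀ j, N ≤ j → c j = 0 := by
  induction N generalizing f with
  | zero => exact ⟨0, ⟨f, by simpa using hf⟩, by simp [assemble_apply], by simp⟩
  | succ N ih =>
    obtain ⟨v, hv, o, ho, h⟩ := P.exists_split _ hf
    have hπ := P.π_ne_zero
    obtain ⟨c, o', h1, h2⟩ := ih (f - v * (P.π ^ (N + 1))⁻¹) (by
      convert ho using 1
      apply mul_left_cancel₀ hπ
      have : P.π * (P.π ^ N * (f - v * (P.π ^ (N + 1))⁻¹)) = P.π ^ (N + 1) * f - v := by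
        have h1 : P.π ^ (N + 1) * (P.π ^ (N + 1))⁻¹ = 1 := mul_inv_cancel₀ (pow_ne_zero _ hπ)
        linear_combination -v * h1
      rw [this, h]; ring)
    refine ⟨c + Finsupp.single N ⟨v, hv⟩, o', ?_, ?_⟩
    · have := P.assemble.map_add (c, o') (Finsupp.single N ⟨v, hv⟩, 0)
      rw [h1, assemble_single] at this
      simpa using this
    · intro j hj
      rw [Finsupp.add_apply, h2 j (by omega), Finsupp.single_eq_of_ne (by omega), add_zero]

/-- Multiplying a vanishing expansion by `π ^ (N + 1)`, where `N` is the top index, puts the top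
digit in `V ∩ π O = 0`. -/
theorem assemble_injective : Function.Injective P.assemble := by
  rw [injective_iff_map_eq_zero]
  rintro ⟨c, o⟩ h
  have hπ := P.π_ne_zero
  have hc : c = 0 := by
    by_contra hc
    have hne : c.support.Nonempty := Finsupp.support_nonempty_iff.2 hc
    set N := c.support.max' hne with hN
    have hmem : N ∈ c.support := Finset.max'_mem _ _
    apply Finsupp.mem_support_iff.1 hmem
    ext
    refine P.eq_zero_of_mem_V _ (c N).2
      (-((∑ j ∈ c.support.erase N, (c j : L) * P.π ^ (N - 1 - j)) + P.π ^ N * o)) ?_ ?_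
    · refine P.O.neg_mem (P.O.add_mem (P.O.sum_mem fun j _ => P.O.mul_mem
        (P.mem_O_of_mem_V _ (c j).2) (P.O.pow_mem P.π_mem _))
        (P.O.mul_mem (P.O.pow_mem P.π_mem _) o.2))
    · rw [assemble_apply, Finsupp.sum, ← Finset.add_sum_erase _ _ hmem] at h
      have h2 := congrArg (P.π ^ (N + 1) * ·) h
      simp only [mul_add, mul_zero, Finset.mul_sum] at h2
      have h3 : ∑ j ∈ c.support.erase N, P.π ^ (N + 1) * ((c j : L) * (P.π ^ (j + 1))⁻¹) =
          P.π * ∑ j ∈ c.support.erase N, (c j : L) * P.π ^ (N - 1 - j) := by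
        rw [Finset.mul_sum]
        refine Finset.sum_congr rfl fun j hj => ?_
        have hlt : j < N := lt_of_le_of_ne (Finset.le_max' _ _ (Finset.mem_of_mem_erase hj))
          (Finset.ne_of_mem_erase hj)
        have : P.π ^ (N + 1) = P.π ^ (j + 1) * (P.π * P.π ^ (N - 1 - j)) := by
          rw [← pow_succ', ← pow_add]; congr 1; omega
        rw [this]; field_simp
      have h4 : P.π ^ (N + 1) * ((c N : L) * (P.π ^ (N + 1))⁻¹) = c N := by field_simp
      rw [h3, h4] at h2
      linear_combination h2
  subst hc
  simpa [assemble_apply] using h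

theorem assemble_surjective : Function.Surjective P.assemble := fun f => by
  obtain ⟨N, hN⟩ := P.exists_pow_mul_mem f
  obtain ⟨c, o, h, -⟩ := P.exists_assemble_eq N f hN
  exact ⟨_, h⟩

/-- The expansion of an element of `L`, as an additive equivalence. -/
def expansion : L ≃+ (ℕ →₀ P.V) × P.O :=
  (AddEquiv.ofBijective P.assemble ⟨P.assemble_injective, P.assemble_surjective⟩).symm

theorem expansion_eq_iff (f : L) (x) : P.expansion f = x ↔ P.assemble x = f := by
  rw [expansion, AddEquiv.symm_apply_eq, eq_comm]; rfl

/-- The digit of `f` at `π ^ (-(j + 1))`. -/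
def coeff (j : ℕ) : L →+ L :=
  P.V.subtype.comp ((Finsupp.applyAddHom j).comp
    ((AddMonoidHom.fst _ _).comp P.expansion.toAddMonoidHom))

theorem coeff_apply (j : ℕ) (f : L) : P.coeff j f = ((P.expansion f).1 j : L) := rfl

theorem coeff_eq {f : L} {c o} (h : P.assemble (c, o) = f) (j : ℕ) : P.coeff j f = c j := by
  rw [coeff_apply, (P.expansion_eq_iff _ _).2 h]

theorem coeff_eq_zero_of_pow_mul_mem {N j : ℕ} {f : L} (hf : P.π ^ N * f ∈ P.O) (hj : N ≤ j) :
    P.coeff j f = 0 := by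
  obtain ⟨c, o, h, h0⟩ := P.exists_assemble_eq N f hf
  rw [P.coeff_eq h, h0 j hj, AddSubgroup.coe_zero]

theorem coeff_eq_zero_of_mem {f : L} (hf : f ∈ P.O) (j : ℕ) : P.coeff j f = 0 :=
  P.coeff_eq_zero_of_pow_mul_mem (N := 0) (by simpa using hf) (Nat.zero_le _)

theorem coeff_div_pow {v : L} (hv : v ∈ P.V) (i j : ℕ) :
    P.coeff j (v / P.π ^ (i + 1)) = if i = j then v else 0 := by
  have h := P.assemble_single i ⟨v, hv⟩ 0
  rw [P.coeff_eq (c := Finsupp.single i ⟨v, hv⟩) (o := 0) (by rw [h]; simp [div_eq_mul_inv])]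
  rw [Finsupp.single_apply]
  split_ifs <;> rfl

/-- The image under `e` of the expansion of `f` is an admissible expansion of `e f`, so uniqueness
identifies the digits. -/
theorem coeff_map {P Q : LocalExpansion L} (e : L →+* L) (hO : ∀ f ∈ P.O, e f ∈ Q.O)
    (hV : ∀ f ∈ P.V, e f ∈ Q.V) (hπ : e P.π = Q.π) (j : ℕ) (f : L) :
    Q.coeff j (e f) = e (P.coeff j f) := by
  obtain ⟨⟨c, o⟩, h⟩ := P.assemble_surjective f
  let eV : P.V →+ Q.V := (e.toAddMonoidHom.comp P.V.subtype).codRestrict Q.V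
    fun x => hV _ x.2
  rw [P.coeff_eq h, Q.coeff_eq (c := c.mapRange eV eV.map_zero) (o := ⟨e o, hO _ o.2⟩)]
  · rw [Finsupp.mapRange_apply]; rfl
  · rw [← h, assemble_apply, assemble_apply, map_add, Finsupp.sum_mapRange_index (by simp),
      Finsupp.sum, Finsupp.sum, map_sum]
    congr 1
    refine Finset.sum_congr rfl fun i _ => ?_
    rw [map_mul, map_inv₀, map_pow, hπ]; rfl

end LocalExpansion

/-- A transitive family of local expansions, permuted by a group of automorphisms. -/
structure OrbitExpansion (G X L : Type*) [Group G] [MulAction G X] [Field L] where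
  φ : G →* (L ≃+* L)
  P : X → LocalExpansion L
  x₀ : X
  rep : X → G
  rep_smul : ∀ x, rep x • x₀ = x
  map_O : ∀ g x, ∀ f ∈ (P x).O, φ g f ∈ (P (g • x)).O
  map_V : ∀ g x, ∀ f ∈ (P x).V, φ g f ∈ (P (g • x)).V
  map_π : ∀ g x, φ g (P x).π = (P (g • x)).π
  finite : ∀ f : L, {x | f ∉ (P x).O}.Finite

namespace OrbitExpansion

variable {G X L : Type*} [Group G] [MulAction G X] [Field L] (E : OrbitExpansion G X L)
  (W : AddSubgroup L)

/-- The contribution of the place `x` to `residue`. -/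
def localResidue (j : ℕ) (x : X) : L →+ L ⧸ W :=
  (QuotientAddGroup.mk' W).comp
    ((E.φ (E.rep x)⁻¹).toRingHom.toAddMonoidHom.comp ((E.P x).coeff j))

theorem localResidue_apply (j : ℕ) (x : X) (f : L) :
    E.localResidue W j x f = QuotientAddGroup.mk' W (E.φ (E.rep x)⁻¹ ((E.P x).coeff j f)) := rfl

theorem localResidue_eq_zero (j : ℕ) (x : X) {f : L} (h : (E.P x).coeff j f = 0) :
    E.localResidue W j x f = 0 := by
  rw [localResidue_apply, h, map_zero, map_zero]

theorem finite_support_localResidue (j : ℕ) (f : L) :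
    (Function.support fun x => E.localResidue W j x f).Finite := by
  refine (E.finite f).subset fun x hx hO => hx ?_
  exact E.localResidue_eq_zero W j x ((E.P x).coeff_eq_zero_of_mem hO j)

/-- The sum over the orbit of the digits of order `j + 1`, transported to the base point. -/
def residue (j : ℕ) : L →+ L ⧸ W where
  toFun f := ∑ᶠ x, E.localResidue W j x f
  map_zero' := by simp
  map_add' f g := by
    simp only [map_add]
    exact finsum_add_distrib (E.finite_support_localResidue W j f)
      (E.finite_support_localResidue W j g)

theorem residue_apply (j : ℕ) (f : L) : E.residue W j f = ∑ᶠ x, E.localResidue W j x f := rfl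

theorem residue_eq_single (j : ℕ) (f : L) (x : X) (h : ∀ y, y ≠ x → (E.P y).coeff j f = 0) :
    E.residue W j f = QuotientAddGroup.mk' W (E.φ (E.rep x)⁻¹ ((E.P x).coeff j f)) := by
  rw [residue_apply, finsum_eq_single _ x fun y hy => E.localResidue_eq_zero W j y (h y hy)]
  rfl

theorem residue_eq_zero (j : ℕ) (f : L) (h : ∀ y, (E.P y).coeff j f = 0) :
    E.residue W j f = 0 := by
  rw [residue_apply]
  exact finsum_eq_zero_of_forall_eq_zero fun y => E.localResidue_eq_zero W j y (h y)

/-- After reindexing the orbit by `g`, the two transports to the base point differ by `(rep (g •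
x))⁻¹ * g * rep x`, which fixes `x₀` and so acts trivially modulo `W`. -/
theorem residue_map (hW : ∀ s : G, s • E.x₀ = E.x₀ → ∀ v, E.φ s v - v ∈ W) (j : ℕ) (g : G)
    (f : L) : E.residue W j (E.φ g f) = E.residue W j f := by
  rw [residue_apply, residue_apply,
    ← finsum_comp_equiv (MulAction.toPerm g : Equiv.Perm X)]
  refine finsum_congr fun x => ?_
  rw [MulAction.toPerm_apply, localResidue_apply, localResidue_apply,
    show (E.P (g • x)).coeff j (E.φ g f) = E.φ g ((E.P x).coeff j f) from
      LocalExpansion.coeff_map (P := E.P x) (E.φ g : L →+* L) (E.map_O g x) (E.map_V g x)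
        (E.map_π g x) j f]
  set c := (E.P x).coeff j f
  have h : E.φ (E.rep (g • x))⁻¹ (E.φ g c) =
      E.φ ((E.rep (g • x))⁻¹ * g * E.rep x) (E.φ (E.rep x)⁻¹ c) := by
    simp only [← RingAut.mul_apply, ← map_mul]
    congr 2; group
  rw [h, ← sub_eq_zero, ← map_sub, ← AddMonoidHom.mem_ker, QuotientAddGroup.ker_mk']
  refine hW _ ?_ _
  rw [mul_smul, mul_smul, E.rep_smul, inv_smul_eq_iff, E.rep_smul]

end OrbitExpansion

end

/-! ### The expansion of `F(y,z)` at an irreducible polynomial -/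

section

section Ring

theorem finite_setOf_dvd {R X : Type*} [CommMonoidWithZero R] [UniqueFactorizationMonoid R]
    (p : X → R) (hp : ∀ x, Irreducible (p x)) (hinj : ∀ x y, Associated (p x) (p y) → x = y)
    {w : R} (hw : w ≠ 0) : {x | p x ∣ w}.Finite := by
  classical
  have h (x : X) (hx : p x ∣ w) : ∃ q ∈ UniqueFactorizationMonoid.factors w, Associated (p x) q :=
    UniqueFactorizationMonoid.exists_mem_factors_of_dvd hw (hp x) hx
  choose! q hq hq' using h
  refine Set.Finite.of_injOn (f := q) (t := (UniqueFactorizationMonoid.factors w).toFinset) ?_ ?_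
    (Finset.finite_toSet _)
  · intro x hx
    simpa using hq x hx
  · intro x hx y hy hxy
    exact hinj x y ((hq' x hx).trans (hxy ▸ (hq' y hy).symm))

variable {R L : Type*} [CommRing R] [Field L] [Algebra R L]

variable (L) in
/-- The fractions whose denominator is not divisible by the prime `p`. -/
def localSubring [IsDomain R] (p : R) (hp : Prime p) : Subring L where
  carrier := {f | ∃ u v : R, ¬ p ∣ v ∧ f * algebraMap R L v = algebraMap R L u}
  mul_mem' := by
    rintro f g ⟨u, v, hv, h⟩ ⟨u', v', hv', h'⟩
    refine ⟨u * u', v * v', fun hd => (hp.dvd_or_dvd hd).elim hv hv', ?_⟩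
    rw [map_mul, map_mul, ← h, ← h']; ring
  one_mem' := ⟨1, 1, hp.not_dvd_one, by simp⟩
  add_mem' := by
    rintro f g ⟨u, v, hv, h⟩ ⟨u', v', hv', h'⟩
    refine ⟨u * v' + u' * v, v * v', fun hd => (hp.dvd_or_dvd hd).elim hv hv', ?_⟩
    simp only [map_mul, map_add, ← h, ← h']; ring
  zero_mem' := ⟨0, 1, hp.not_dvd_one, by simp⟩
  neg_mem' := by
    rintro f ⟨u, v, hv, h⟩
    exact ⟨-u, v, hv, by rw [neg_mul, h, map_neg]⟩

variable [IsDomain R] {p : R} {hp : Prime p}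

theorem algebraMap_mem_localSubring (u : R) : algebraMap R L u ∈ localSubring L p hp :=
  ⟨u, 1, hp.not_dvd_one, by simp⟩

include hp in
theorem exists_not_dvd_eq_pow_mul [WfDvdMonoid R] {v : R} (hv : v ≠ 0) :
    ∃ (n : ℕ) (w : R), ¬ p ∣ w ∧ v = p ^ n * w :=
  WfDvdMonoid.max_power_factor hv hp.irreducible

theorem exists_pow_mul_mem_localSubring [IsFractionRing R L] [WfDvdMonoid R] (f : L) :
    ∃ N : ℕ, algebraMap R L p ^ N * f ∈ localSubring L p hp := by
  obtain ⟨u, v, hv, rfl⟩ := IsFractionRing.div_surjective R f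
  have hv0 := nonZeroDivisors.ne_zero hv
  obtain ⟨N, w, hw, rfl⟩ := exists_not_dvd_eq_pow_mul (hp := hp) hv0
  refine ⟨N, u, w, hw, ?_⟩
  have h : algebraMap R L (p ^ N * w) ≠ 0 := by
    rwa [Ne, IsFractionRing.to_map_eq_zero_iff]
  calc _ = algebraMap R L u / algebraMap R L (p ^ N * w) * algebraMap R L (p ^ N * w) := by
        rw [map_mul _ (p ^ N), map_pow]; ring
    _ = _ := div_mul_cancel₀ _ h

theorem mem_localSubring_of_mul_eq {f : L} {u v : R} (hv : ¬ p ∣ v)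
    (h : f * algebraMap R L v = algebraMap R L u) : f ∈ localSubring L p hp := ⟨u, v, hv, h⟩

/-- The exact power of `p` in a denominator `v` bounds the pole order of `f` at `p`; a pole of order
above `j` therefore needs `p ^ (j + 1)` in `v`. -/
theorem pow_dvd_of_pow_mul_not_mem [WfDvdMonoid R] {f : L} {u v : R} (j : ℕ) (hv : v ≠ 0)
    (h : f * algebraMap R L v = algebraMap R L u)
    (hf : ∀ N ≤ j, algebraMap R L p ^ N * f ∉ localSubring L p hp) : p ^ (j + 1) ∣ v := by
  obtain ⟨N, w, hw, rfl⟩ := exists_not_dvd_eq_pow_mul (hp := hp) hv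
  by_cases hN : N ≤ j
  · refine absurd ⟨u, w, hw, ?_⟩ (hf N hN)
    rw [← h, map_mul, map_pow]; ring
  · exact Dvd.dvd.mul_right (pow_dvd_pow _ (by omega)) _

end Ring

variable {F : Type*} [Field F]

theorem mul_denom (f : RatYZ F) :
    f * toRat (denom f) = toRat (IsFractionRing.num (PolyYZ F) f) :=
  IsFractionRing.num_mul_den_eq_num_iff_eq.2 rfl

theorem denom_ne_zero (f : RatYZ F) : denom f ≠ 0 :=
  nonZeroDivisors.ne_zero (SetLike.coe_mem _)

theorem isRelPrime_num_denom (f : RatYZ F) :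
    IsRelPrime (IsFractionRing.num (PolyYZ F) f) (denom f) :=
  IsFractionRing.num_den_reduced (PolyYZ F) f

namespace IsMonicIrred

variable {d : PolyYZ F} (hd : IsMonicIrred d)

include hd

theorem ne_zero : d ≠ 0 := hd.2.1.ne_zero

theorem prime : Prime d := hd.2.1.prime

theorem isPrimitive : d.IsPrimitive :=
  hd.2.1.isPrimitive (natDegree_pos_iff_degree_pos.2 hd.2.2).ne'

theorem not_dvd_C {b : F[X]} (hb : b ≠ 0) : ¬ d ∣ C b := fun h => by
  have := eq_zero_of_dvd_of_degree_lt h (by rw [degree_C hb]; exact hd.2.2)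
  exact hb (C_eq_zero.1 this)

/-- Thanks to the normalization, distinct polynomials in a shift orbit give distinct places, so the
orbit itself can index the expansions. -/
theorem eq_of_associated {e : PolyYZ F} (he : IsMonicIrred e) (h : Associated d e) : d = e := by
  obtain ⟨u, rfl⟩ := h
  obtain ⟨v, hv, hvu⟩ := isUnit_iff.1 u.isUnit
  obtain ⟨w, hw, rfl⟩ := isUnit_iff.1 hv
  have h1 := he.1
  rw [leadingCoeff_mul, leadingCoeff_mul, hd.1, ← hvu, leadingCoeff_C, leadingCoeff_C, one_mul]
    at h1
  rw [← hvu, h1]; simp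

theorem eq_of_dvd {e : PolyYZ F} (he : IsMonicIrred e) (h : d ∣ e) : d = e :=
  hd.eq_of_associated he (hd.2.1.associated_of_dvd he.2.1 h)

/-- Over the field `F(y)`, `d` stays irreducible by Gauss's lemma, so `v` is invertible modulo `d`.
The polynomial `a / N` is the remainder of `u v⁻¹` modulo `d`, and `N` clears denominators. -/
theorem exists_split {u v : PolyYZ F} (hv : ¬ d ∣ v) :
    ∃ (N : F[X]) (a e : PolyYZ F), N ≠ 0 ∧ a.degree < d.degree ∧ C N * u = a * v + d * e := by
  let k := FractionRing F[X]
  let ι := algebraMap F[X] k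
  have hι : Function.Injective ι := IsFractionRing.injective _ _
  have hirr : Irreducible (d.map ι) :=
    hd.isPrimitive.irreducible_iff_irreducible_map_fraction_map.1 hd.2.1
  have hndvd : ¬ d.map ι ∣ v.map ι := by
    rintro ⟨g, hg⟩
    -- Since `d` is primitive, a cofactor of `d` in a polynomial over `F[y]` already has
    -- coefficients in `F[y]`.
    have hl : d.map ι * g ∈ lifts ι := by rw [← hg]; exact ⟨v, rfl⟩
    obtain ⟨g', hg'⟩ := hd.isPrimitive.map_mul_mem_lifts_iff.1 hl
    refine hv ⟨g', map_injective ι hι ?_⟩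
    rw [hg, Polynomial.map_mul]; congr 1; exact hg'.symm
  obtain ⟨t, s, hts⟩ := (hirr.coprime_iff_not_dvd).2 hndvd
  have hd0 : d.map ι ≠ 0 := hirr.ne_zero
  set c := (u.map ι * s) % d.map ι with hc
  set q := (u.map ι * s) / d.map ι with hq
  have hdiv : d.map ι * q + c = u.map ι * s := EuclideanDomain.div_add_mod _ _
  have hcdeg : c.degree < d.degree := by
    rw [← degree_map_eq_of_injective hι d]; exact degree_mod_lt _ hd0
  set e := u.map ι * t + q * v.map ι with he
  have hu : u.map ι = c * v.map ι + d.map ι * e := by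
    linear_combination (-u.map ι) * hts - v.map ι * hdiv
  obtain ⟨b₁, hb₁, h₁⟩ := IsLocalization.integerNormalization_spec (nonZeroDivisors F[X]) c
  obtain ⟨b₂, hb₂, h₂⟩ := IsLocalization.integerNormalization_spec (nonZeroDivisors F[X]) e
  set c' := IsLocalization.integerNormalization (nonZeroDivisors F[X]) c
  set e' := IsLocalization.integerNormalization (nonZeroDivisors F[X]) e
  have hb₁0 := nonZeroDivisors.ne_zero hb₁
  have hb₂0 := nonZeroDivisors.ne_zero hb₂
  have h₁' : c'.map ι = C (ι b₁) * c := by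
    rw [← smul_eq_C_mul, algebraMap_smul]; exact h₁
  have h₂' : e'.map ι = C (ι b₂) * e := by
    rw [← smul_eq_C_mul, algebraMap_smul]; exact h₂
  refine ⟨b₁ * b₂, C b₂ * c', C b₁ * e', mul_ne_zero hb₁0 hb₂0, ?_, ?_⟩
  · rw [degree_C_mul hb₂0, ← degree_map_eq_of_injective hι, h₁', degree_C_mul]
    · exact hcdeg
    · rwa [Ne, map_eq_zero_iff ι hι]
  · apply map_injective ι hι
    simp only [Polynomial.map_mul, Polynomial.map_add, map_C, h₁', h₂', map_mul]
    rw [hu]; ring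

/-- The local expansion of `F(y,z)` at `d`. -/
def localExpansion : LocalExpansion (RatYZ F) where
  O := localSubring (RatYZ F) d hd.prime
  -- The digits are the elements of `F(y)[z]` of degree less than `deg_z d`: the canonical
  -- representatives of the residue field.
  V :=
    { carrier := {f | ∃ (a : PolyYZ F) (b : F[X]), b ≠ 0 ∧ a.degree < d.degree ∧
        f * toRat (C b) = toRat a}
      add_mem' := by
        rintro f g ⟨a, b, hb, ha, h⟩ ⟨a', b', hb', ha', h'⟩
        refine ⟨a * C b' + a' * C b, b * b', mul_ne_zero hb hb',
          (degree_add_le _ _).trans_lt (max_lt ?_ ?_), ?_⟩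
        · rwa [mul_comm, degree_C_mul hb']
        · rwa [mul_comm, degree_C_mul hb]
        · simp only [toRat, map_mul, map_add] at h h' ⊢
          rw [← h, ← h']; ring
      zero_mem' := ⟨0, 1, one_ne_zero, by
        rw [degree_zero]; exact bot_lt_iff_ne_bot.2 (degree_ne_bot.2 hd.ne_zero), by simp⟩
      neg_mem' := by
        rintro f ⟨a, b, hb, ha, h⟩
        exact ⟨-a, b, hb, by rwa [degree_neg], by rw [neg_mul, h, toRat, toRat, map_neg]⟩ }
  π := toRat d
  π_ne_zero := by simpa using hd.ne_zero
  π_mem := algebraMap_mem_localSubring _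
  mem_O_of_mem_V := by
    rintro f ⟨a, b, hb, ha, h⟩
    exact ⟨a, C b, hd.not_dvd_C hb, h⟩
  eq_zero_of_mem_V := by
    rintro f ⟨a, b, hb, ha, h⟩ o ⟨u, v, hv, ho⟩ rfl
    have h1 : a * v = d * (u * C b) := by
      apply IsFractionRing.injective (PolyYZ F) (RatYZ F)
      simp only [map_mul, toRat] at h ho ⊢
      rw [← h, ← ho]; ring
    have h2 : a = 0 := eq_zero_of_dvd_of_degree_lt
      ((hd.prime.dvd_or_dvd ⟨_, h1⟩).resolve_right hv) ha
    rw [h2, show toRat (0 : PolyYZ F) = 0 from map_zero _] at h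
    exact (mul_eq_zero.1 h).resolve_right (by simpa using hb)
  exists_split := by
    rintro f ⟨u, v, hv, h⟩
    obtain ⟨N, a, e, hN, ha, hs⟩ := hd.exists_split (u := u) hv
    have hN0 : toRat (C N) ≠ 0 := by simpa using hN
    have hv0 : toRat v ≠ 0 := by
      rw [toRat, Ne, IsFractionRing.to_map_eq_zero_iff]; rintro rfl; exact hv (dvd_zero _)
    refine ⟨toRat a / toRat (C N), ⟨a, N, hN, ha, by field_simp⟩,
      toRat e / (toRat (C N) * toRat v), ⟨e, C N * v,
      fun hh => (hd.prime.dvd_or_dvd hh).elim (hd.not_dvd_C hN) hv, ?_⟩, ?_⟩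
    · rw [map_mul]; field_simp
    · have := congrArg toRat hs
      simp only [toRat, map_mul, map_add] at this hN0 hv0 h ⊢
      rw [eq_div_of_mul_eq hv0 h]
      field_simp
      linear_combination this
  exists_pow_mul_mem := exists_pow_mul_mem_localSubring

theorem mem_localExpansion_V {f : RatYZ F} : f ∈ hd.localExpansion.V ↔
    ∃ (a : PolyYZ F) (b : F[X]), b ≠ 0 ∧ a.degree < d.degree ∧ f * toRat (C b) = toRat a := Iff.rfl

theorem coeff_simpleFrac_self {a : PolyYZ F} {b : F[X]} (hb : b ≠ 0) (ha : a.degree < d.degree)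
    (i j : ℕ) : hd.localExpansion.coeff j (simpleFrac a b d (i + 1)) =
      if i = j then toRat a / toRat (C b) else 0 := by
  have hb0 : toRat (C b) ≠ 0 := by simpa using hb
  rw [← LocalExpansion.coeff_div_pow _ (hd.mem_localExpansion_V.2 ⟨a, b, hb, ha, by field_simp⟩),
    simpleFrac, div_div]
  rfl

theorem simpleFrac_mem {e : PolyYZ F} (he : IsMonicIrred e) (hne : e ≠ d) (a : PolyYZ F)
    {b : F[X]} (hb : b ≠ 0) (i : ℕ) :
    simpleFrac a b e i ∈ hd.localExpansion.O := by
  refine mem_localSubring_of_mul_eq (hp := hd.prime) (u := a) (v := C b * e ^ i) ?_ ?_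
  · intro h
    rcases hd.prime.dvd_or_dvd h with h | h
    · exact hd.not_dvd_C hb h
    · exact hne (hd.eq_of_dvd he (hd.prime.dvd_of_dvd_pow h)).symm
  · have h1 : toRat (C b) ≠ 0 := by simpa using hb
    have h2 : toRat e ≠ 0 := by simpa using he.ne_zero
    rw [simpleFrac, map_mul, map_pow]
    field_simp

theorem coeff_simpleFrac_of_ne {e : PolyYZ F} (he : IsMonicIrred e) (hne : e ≠ d) (a : PolyYZ F)
    {b : F[X]} (hb : b ≠ 0) (i j : ℕ) :
    hd.localExpansion.coeff j (simpleFrac a b e i) = 0 :=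
  LocalExpansion.coeff_eq_zero_of_mem _ (hd.simpleFrac_mem he hne a hb i) _

theorem mem_of_isPolyInZ {f : RatYZ F} (hf : IsPolyInZ f) : f ∈ hd.localExpansion.O := by
  obtain ⟨u, v, hv, rfl⟩ := hf
  have h1 : toRat (C v) ≠ 0 := by simpa using hv
  exact mem_localSubring_of_mul_eq (hp := hd.prime) (u := u) (v := C v)
    (hd.not_dvd_C hv) (by field_simp)

theorem pow_dvd_of_coeff_ne_zero {f : RatYZ F} {j : ℕ} (h : hd.localExpansion.coeff j f ≠ 0) :
    d ^ (j + 1) ∣ denom f := by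
  exact pow_dvd_of_pow_mul_not_mem (L := RatYZ F) (hp := hd.prime) j (denom_ne_zero f)
    (mul_denom f) fun N hN hmem => h (hd.localExpansion.coeff_eq_zero_of_pow_mul_mem hmem hN)

theorem not_mem_of_dvd_denom {f : RatYZ F} (h : d ∣ denom f) : f ∉ hd.localExpansion.O := by
  rintro ⟨u, v, hv, huv⟩
  have h0 := mul_denom f
  have h2 := isRelPrime_num_denom f
  generalize IsFractionRing.num (PolyYZ F) f = w at h0 h2
  generalize denom f = D at h h0 h2
  have h1 : w * v = u * D := by
    apply IsFractionRing.injective (PolyYZ F) (RatYZ F)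
    rw [map_mul, map_mul, ← huv]
    change f * toRat D = algebraMap _ _ w at h0
    rw [← h0]; ring
  have h3 : d ∣ w * v := h1 ▸ h.mul_left u
  exact hd.prime.not_isUnit (h2 ((hd.prime.dvd_or_dvd h3).resolve_right hv) h)

end IsMonicIrred

end

/-! ### The group of shifts and its action on polynomials, fractions and expansions -/

section

variable {F : Type*} [Field F]

theorem sigmaZ_zpow_apply (k : ℤ) (p : PolyYZ F) : (sigmaZ ^ k) p = taylor (k : F[X]) p := by
  have h1 (p : PolyYZ F) : sigmaZ p = taylor 1 p := by
    simp [sigmaZ, taylor_apply, comp, aeval_def, algEquivAevalXAddC_apply]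
  have h2 (p : PolyYZ F) : sigmaZ⁻¹ p = taylor (-1) p := by
    rw [AlgEquiv.aut_inv, AlgEquiv.symm_apply_eq, h1, taylor_taylor]; simp
  induction k generalizing p with
  | zero => simp
  | succ n ih => rw [zpow_add_one, AlgEquiv.mul_apply, ih, h1, taylor_taylor]; simp
  | pred n ih =>
    rw [zpow_sub_one, AlgEquiv.mul_apply, ih, h2, taylor_taylor]; simp [sub_eq_add_neg]

theorem sigmaY_zpow_apply (l : ℤ) (p : PolyYZ F) :
    (sigmaY ^ l) p = p.map (taylorAlgHom (l : F)).toRingHom := by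
  have h0 (r s : F) : (taylorAlgHom r).toRingHom.comp (taylorAlgHom s).toRingHom =
      (taylorAlgHom (r + s)).toRingHom := RingHom.ext fun p => taylor_taylor p r s
  have h3 : (taylorAlgHom (0 : F)).toRingHom = RingHom.id _ := RingHom.ext fun p => taylor_zero p
  have h1 (p : PolyYZ F) : sigmaY p = p.map (taylorAlgHom (1 : F)).toRingHom := by
    simp only [sigmaY, coe_mapAlgEquiv]
    congr 1
  have h2 (p : PolyYZ F) : sigmaY⁻¹ p = p.map (taylorAlgHom (-1 : F)).toRingHom := by
    rw [AlgEquiv.aut_inv, AlgEquiv.symm_apply_eq, h1, map_map, h0, add_neg_cancel, h3, map_id]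
  induction l generalizing p with
  | zero => rw [zpow_zero, Int.cast_zero, h3, map_id]; rfl
  | succ n ih => rw [zpow_add_one, AlgEquiv.mul_apply, ih, h1, map_map, h0]; simp
  | pred n ih =>
    rw [zpow_sub_one, AlgEquiv.mul_apply, ih, h2, map_map, h0]; simp [sub_eq_add_neg]

theorem commute_sigma : Commute (sigmaY : PolyYZ F ≃ₐ[F] PolyYZ F) sigmaZ := by
  ext p : 1
  have hy := sigmaY_zpow_apply (F := F) 1
  have hz := sigmaZ_zpow_apply (F := F) 1
  simp only [zpow_one] at hy hz
  rw [AlgEquiv.mul_apply, AlgEquiv.mul_apply, hy, hz, hz, hy, map_taylor]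
  simp

variable (F) in
/-- The group of the shifts `σ_y ^ l σ_z ^ k`. -/
def shiftGroup : Subgroup (PolyYZ F ≃ₐ[F] PolyYZ F) where
  carrier := {g | ∃ l k : ℤ, g = sigmaY ^ l * sigmaZ ^ k}
  mul_mem' := by
    rintro _ _ ⟨l, k, rfl⟩ ⟨l', k', rfl⟩
    refine ⟨l + l', k + k', ?_⟩
    have h := (commute_sigma (F := F)).zpow_zpow l' k
    rw [zpow_add, zpow_add, mul_assoc, mul_assoc, ← mul_assoc (sigmaZ ^ k), ← h.eq, mul_assoc]
  one_mem' := ⟨0, 0, by simp⟩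
  inv_mem' := by
    rintro _ ⟨l, k, rfl⟩
    refine ⟨-l, -k, ?_⟩
    rw [mul_inv_rev, ← zpow_neg, ← zpow_neg, ((commute_sigma (F := F)).zpow_zpow (-l) (-k)).eq]

theorem shift_apply (l k : ℤ) (p : PolyYZ F) :
    (sigmaY ^ l * sigmaZ ^ k : PolyYZ F ≃ₐ[F] PolyYZ F) p =
    (taylor (k : F[X]) p).map (taylorAlgHom (l : F)).toRingHom := by
  rw [AlgEquiv.mul_apply, sigmaZ_zpow_apply, sigmaY_zpow_apply]

theorem shift_C (l k : ℤ) (b : F[X]) :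
    (sigmaY ^ l * sigmaZ ^ k : PolyYZ F ≃ₐ[F] PolyYZ F) (C b) = C (taylor (l : F) b) := by
  rw [shift_apply, taylor_C, map_C]; rfl

theorem degree_shift {g : PolyYZ F ≃ₐ[F] PolyYZ F} (hg : g ∈ shiftGroup F) (p : PolyYZ F) :
    (g p).degree = p.degree := by
  obtain ⟨l, k, rfl⟩ := hg
  rw [shift_apply, degree_map_eq_of_injective (taylor_injective (l : F)), degree_taylor]

/-- Shifts do not change leading coefficients, so the whole orbit of `d` stays normalized and
uniformizers go exactly to uniformizers. -/
theorem IsMonicIrred.shift {g : PolyYZ F ≃ₐ[F] PolyYZ F} (hg : g ∈ shiftGroup F) {d : PolyYZ F}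
    (hd : IsMonicIrred d) : IsMonicIrred (g d) := by
  refine ⟨?_, (MulEquiv.irreducible_iff g).2 hd.2.1, by rw [degree_shift hg]; exact hd.2.2⟩
  obtain ⟨l, k, rfl⟩ := hg
  rw [shift_apply, leadingCoeff_map_of_injective (taylor_injective (l : F)), leadingCoeff_taylor]
  exact (leadingCoeff_taylor _ _).trans hd.1

theorem exists_shift_C {g : PolyYZ F ≃ₐ[F] PolyYZ F} (hg : g ∈ shiftGroup F) (b : F[X]) :
    ∃ c : F[X], g (C b) = C c ∧ c.natDegree = b.natDegree := by
  obtain ⟨l, k, rfl⟩ := hg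
  exact ⟨_, shift_C l k b, natDegree_taylor _ _⟩

theorem mem_orbit_iff {p q : PolyYZ F} :
    p ∈ MulAction.orbit (shiftGroup F) q ↔ ShiftEquiv p q := by
  constructor
  · rintro ⟨⟨_, l, k, rfl⟩, rfl⟩
    exact ⟨l, k, rfl⟩
  · rintro ⟨l, k, rfl⟩
    exact ⟨⟨_, l, k, rfl⟩, rfl⟩

theorem ShiftEquiv.refl (p : PolyYZ F) : ShiftEquiv p p :=
  mem_orbit_iff.1 (MulAction.mem_orbit_self p)

theorem ShiftEquiv.symm {p q : PolyYZ F} (h : ShiftEquiv p q) : ShiftEquiv q p :=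
  mem_orbit_iff.1 (MulAction.mem_orbit_symm.1 (mem_orbit_iff.2 h))

theorem ShiftEquiv.trans {p q s : PolyYZ F} (h : ShiftEquiv p q) (h' : ShiftEquiv q s) :
    ShiftEquiv p s := by
  rw [← mem_orbit_iff] at *
  rwa [← MulAction.orbit_eq_iff.2 h']

theorem ShiftEquiv.degree_eq {p q : PolyYZ F} (h : ShiftEquiv p q) : p.degree = q.degree := by
  obtain ⟨l, k, rfl⟩ := h
  exact degree_shift ⟨l, k, rfl⟩ q

theorem ShiftEquiv.isMonicIrred {p q : PolyYZ F} (h : ShiftEquiv p q) (hq : IsMonicIrred q) :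
    IsMonicIrred p := by
  obtain ⟨l, k, rfl⟩ := h
  exact hq.shift ⟨l, k, rfl⟩

theorem ratExt_toRat (τ : PolyYZ F ≃ₐ[F] PolyYZ F) (p : PolyYZ F) :
    ratExt τ (toRat p) = toRat (τ p) :=
  IsFractionRing.algEquivOfAlgEquiv_algebraMap _ _

theorem ratExt_mul (g h : PolyYZ F ≃ₐ[F] PolyYZ F) (f : RatYZ F) :
    ratExt (g * h) f = ratExt g (ratExt h f) := by
  obtain ⟨u, v, -, rfl⟩ := IsFractionRing.div_surjective (PolyYZ F) f
  have (w : PolyYZ F) : ratExt (g * h) (algebraMap _ _ w) =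
      ratExt g (ratExt h (algebraMap _ _ w)) := by
    rw [ratExt_toRat, ratExt_toRat, ratExt_toRat]; rfl
  simp only [map_div₀, this]

variable (F) in
/-- The action of the shifts on `F(y,z)`. -/
def ratShift : (PolyYZ F ≃ₐ[F] PolyYZ F) →* (RatYZ F ≃+* RatYZ F) :=
  MonoidHom.mk' (fun g => (ratExt g).toRingEquiv) fun g h => RingEquiv.ext (ratExt_mul g h)

theorem ratShift_apply (g : PolyYZ F ≃ₐ[F] PolyYZ F) (f : RatYZ F) :
    ratShift F g f = ratExt g f := rfl

theorem ratShift_toRat (g : PolyYZ F ≃ₐ[F] PolyYZ F) (p : PolyYZ F) :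
    ratShift F g (toRat p) = toRat (g p) := ratExt_toRat g p

theorem ratShift_mem_localSubring (g : PolyYZ F ≃ₐ[F] PolyYZ F) {p q : PolyYZ F} (hp : Prime p)
    (hq : Prime q) (hpq : g p = q) {f : RatYZ F} (hf : f ∈ localSubring (RatYZ F) p hp) :
    ratShift F g f ∈ localSubring (RatYZ F) q hq := by
  obtain ⟨u, v, hv, h⟩ := hf
  refine ⟨g u, g v, by rwa [← hpq, map_dvd_iff], ?_⟩
  have := congrArg (ratShift F g) h
  rwa [map_mul, ratShift_toRat, ratShift_toRat] at this

theorem finite_setOf_not_mem {X : Type*} (p : X → PolyYZ F) (hp : ∀ x, Prime (p x))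
    (hinj : ∀ x y, Associated (p x) (p y) → x = y) (f : RatYZ F) :
    {x | f ∉ localSubring (RatYZ F) (p x) (hp x)}.Finite := by
  refine (finite_setOf_dvd p (fun x => (hp x).irreducible) hinj (denom_ne_zero f)).subset ?_
  intro x hx
  by_contra h
  exact hx ⟨_, _, h, mul_denom f⟩

/-- The local expansions of `F(y,z)` at the shifts of `d`. -/
def orbitExpansion {d : PolyYZ F} (hd : IsMonicIrred d) :
    OrbitExpansion (shiftGroup F) (MulAction.orbit (shiftGroup F) d) (RatYZ F) where
  φ := (ratShift F).comp (shiftGroup F).subtype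
  P x := ((mem_orbit_iff.1 x.2).isMonicIrred hd).localExpansion
  x₀ := ⟨d, MulAction.mem_orbit_self d⟩
  rep x := (MulAction.exists_smul_eq (shiftGroup F)
    (⟨d, MulAction.mem_orbit_self d⟩ : MulAction.orbit (shiftGroup F) d) x).choose
  rep_smul x := (MulAction.exists_smul_eq (shiftGroup F)
    (⟨d, MulAction.mem_orbit_self d⟩ : MulAction.orbit (shiftGroup F) d) x).choose_spec
  map_O g x f hf := ratShift_mem_localSubring g.1
    ((mem_orbit_iff.1 x.2).isMonicIrred hd).prime
    ((mem_orbit_iff.1 (g • x).2).isMonicIrred hd).prime rfl hf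
  map_V := by
    rintro g x f ⟨a, b, hb, ha, h⟩
    obtain ⟨c, hc, -⟩ := exists_shift_C g.2 b
    refine ⟨g.1 a, c, ?_, ?_, ?_⟩
    · rintro rfl
      exact hb (by simpa using hc)
    · rw [degree_shift g.2]
      exact ha.trans_eq (degree_shift g.2 _).symm
    · have := congrArg (ratShift F g) h
      rwa [map_mul, ratShift_toRat, ratShift_toRat, hc] at this
  map_π g x := ratShift_toRat g.1 _
  finite f := finite_setOf_not_mem (fun x : MulAction.orbit (shiftGroup F) d => x.1)
    (fun x => ((mem_orbit_iff.1 x.2).isMonicIrred hd).prime)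
    (fun x y h => Subtype.ext (((mem_orbit_iff.1 x.2).isMonicIrred hd).eq_of_associated
      ((mem_orbit_iff.1 y.2).isMonicIrred hd) h)) f

end

/-! ### The stabilizer of a polynomial in the group of shifts -/

section

variable {F : Type*} [Field F]

/-- A polynomial with a nonzero period `k` takes the same value at all `k n`; in characteristic zero
these are infinitely many points, so it is constant in `z`. -/
theorem eq_zero_of_sigmaZ_zpow_eq [CharZero F] {k : ℤ} {d : PolyYZ F} (hd : 0 < d.degree)
    (h : (sigmaZ ^ k) d = d) : k = 0 := by
  by_contra hk
  have h1 (n : ℤ) : (sigmaZ ^ (k * n)) d = d := by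
    have : (sigmaZ ^ k : PolyYZ F ≃ₐ[F] PolyYZ F) ∈
      MulAction.stabilizer (PolyYZ F ≃ₐ[F] PolyYZ F) d := h
    rw [zpow_mul]
    exact Subgroup.zpow_mem _ this n
  have h2 : d = C (d.eval 0) := by
    refine eq_of_infinite_eval_eq _ _ ((Set.infinite_range_of_injective
      (f := fun n : ℤ => ((k * n : ℤ) : F[X])) ?_).mono ?_)
    · intro a b hab
      exact mul_left_cancel₀ hk (Int.cast_injective hab)
    · rintro _ ⟨n, rfl⟩
      have := congrArg (eval 0) (h1 n)
      rw [sigmaZ_zpow_apply, taylor_eval, zero_add] at this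
      simpa using this
  rw [h2] at hd
  exact hd.not_ge degree_C_le

/-- A polynomial fixed by `σ_y ^ l σ_z ^ k` with `l ≠ 0` is a polynomial in `l z - k y`. -/
theorem exists_eq_aeval_of_shift_eq [CharZero F] {l k : ℤ} (hl : l ≠ 0) {d : PolyYZ F}
    (h : (sigmaY ^ l * sigmaZ ^ k : PolyYZ F ≃ₐ[F] PolyYZ F) d = d) :
    ∃ p : F[X], d = aeval (linForm (-k) l) p := by
  have h1 (n : ℤ) : (sigmaY ^ (l * n) * sigmaZ ^ (k * n) : PolyYZ F ≃ₐ[F] PolyYZ F) d = d := by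
    have : (sigmaY ^ l * sigmaZ ^ k : PolyYZ F ≃ₐ[F] PolyYZ F) ∈
      MulAction.stabilizer (PolyYZ F ≃ₐ[F] PolyYZ F) d := h
    have := Subgroup.zpow_mem _ this n
    rwa [((commute_sigma (F := F)).zpow_zpow l k).mul_zpow, ← zpow_mul, ← zpow_mul] at this
  -- `Φ d` is `d(y + l T, z + k T)` as a polynomial in `T`. It equals `d` at every integer `T`,
  -- hence identically; setting `T = -y / l` gives `d = d(0, (l z - k y) / l)`.
  let Φ : PolyYZ F →+* Polynomial (PolyYZ F) :=
    eval₂RingHom (eval₂RingHom (C.comp (C.comp C)) (C (C X) + X * (l : Polynomial (PolyYZ F))))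
      (C X + X * (k : Polynomial (PolyYZ F)))
  have h2 (n : ℤ) : eval (n : PolyYZ F) (Φ d) =
      (sigmaY ^ (l * n) * sigmaZ ^ (k * n) : PolyYZ F ≃ₐ[F] PolyYZ F) d := by
    have : (evalRingHom (n : PolyYZ F)).comp Φ =
        (sigmaY ^ (l * n) * sigmaZ ^ (k * n) : PolyYZ F ≃ₐ[F] PolyYZ F) := by
      apply ringHom_ext'
      · apply ringHom_ext'
        · ext x
          simp [Φ, sigmaZ_zpow_apply, sigmaY_zpow_apply]
        · simp [Φ, sigmaZ_zpow_apply, sigmaY_zpow_apply, mul_comm]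
      · simp [Φ, sigmaZ_zpow_apply, sigmaY_zpow_apply, mul_comm]
    exact RingHom.congr_fun this d
  have h3 : Φ d = C d := by
    refine eq_of_infinite_eval_eq _ _ ((Set.infinite_range_of_injective
      (f := fun n : ℤ => (n : PolyYZ F)) Int.cast_injective).mono ?_)
    rintro _ ⟨n, rfl⟩
    simp only [Set.mem_ofPred_eq, h2, h1, eval_C]
  have hl' : (l : F) ≠ 0 := Int.cast_ne_zero.2 hl
  have h4 : (evalRingHom (-C (C ((l : F)⁻¹) * X))).comp Φ =
      (aeval (linForm (-k) l)).toRingHom.comp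
        ((compRingHom (C (l : F)⁻¹ * X)).comp (mapRingHom (evalRingHom 0))) := by
    have h5 : (C (C ((l : F)⁻¹)) * (l : PolyYZ F)) = 1 := by
      rw [← map_intCast (C.comp C : F →+* PolyYZ F) l, RingHom.comp_apply, ← C_mul, ← C_mul,
        inv_mul_cancel₀ hl', C_1, C_1]
    apply ringHom_ext'
    · apply ringHom_ext'
      · ext x
        simp [Φ]
      · simp [Φ]
        linear_combination (-(C X : PolyYZ F)) * h5
    · simp [Φ, linForm]
      linear_combination (-(X : PolyYZ F)) * h5
  have h6 := RingHom.congr_fun h4 d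
  rw [RingHom.comp_apply, h3, coe_evalRingHom, eval_C] at h6
  exact ⟨_, h6⟩

/-- Eliminating `σ_y` between two stabilizing shifts leaves a power of `σ_z` fixing `d`, which must
be trivial. So the stabilizing pairs `(l, k)` are proportional, and dividing one by its gcd gives
the primitive direction `(β, -α)`. -/
theorem shift_stabilizer [CharZero F] {d : PolyYZ F} (hd : 0 < d.degree) :
    (∀ l k : ℤ, (sigmaY ^ l * sigmaZ ^ k : PolyYZ F ≃ₐ[F] PolyYZ F) d = d → l = 0 ∧ k = 0) ∨
    ∃ α β : ℤ, β ≠ 0 ∧ IsIntegerLinear α β d ∧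
      ∀ l k : ℤ, (sigmaY ^ l * sigmaZ ^ k : PolyYZ F ≃ₐ[F] PolyYZ F) d = d →
        ∃ t : ℤ, (sigmaY ^ l * sigmaZ ^ k : PolyYZ F ≃ₐ[F] PolyYZ F) =
          (sigmaY ^ β * sigmaZ ^ (-α)) ^ t := by
  by_cases htriv : ∀ l k : ℤ, (sigmaY ^ l * sigmaZ ^ k : PolyYZ F ≃ₐ[F] PolyYZ F) d = d →
      l = 0 ∧ k = 0
  · exact Or.inl htriv
  right
  have hzpow (l k t : ℤ) : (sigmaY ^ (l * t) * sigmaZ ^ (k * t) : PolyYZ F ≃ₐ[F] PolyYZ F) =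
      (sigmaY ^ l * sigmaZ ^ k) ^ t := by
    rw [((commute_sigma (F := F)).zpow_zpow l k).mul_zpow, zpow_mul, zpow_mul]
  have hfix (l k t : ℤ) (h : (sigmaY ^ l * sigmaZ ^ k : PolyYZ F ≃ₐ[F] PolyYZ F) d = d) :
      (sigmaY ^ (l * t) * sigmaZ ^ (k * t) : PolyYZ F ≃ₐ[F] PolyYZ F) d = d := by
    rw [hzpow]
    have : (sigmaY ^ l * sigmaZ ^ k : PolyYZ F ≃ₐ[F] PolyYZ F) ∈
      MulAction.stabilizer (PolyYZ F ≃ₐ[F] PolyYZ F) d := h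
    exact Subgroup.zpow_mem _ this t
  have key (l k l' k' : ℤ) (h : (sigmaY ^ l * sigmaZ ^ k : PolyYZ F ≃ₐ[F] PolyYZ F) d = d)
      (h' : (sigmaY ^ l' * sigmaZ ^ k' : PolyYZ F ≃ₐ[F] PolyYZ F) d = d) : k * l' = k' * l := by
    have h1 := hfix l k l' h
    have h2 := hfix l' k' l h'
    rw [mul_comm l l', AlgEquiv.mul_apply] at h1
    rw [AlgEquiv.mul_apply] at h2
    have h3 := (sigmaY ^ (l' * l)).injective (h1.trans h2.symm)
    have h4 : (sigmaZ ^ (k * l' - k' * l)) d = d := by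
      rw [sub_eq_neg_add, zpow_add, AlgEquiv.mul_apply, h3, zpow_neg, AlgEquiv.aut_inv,
        AlgEquiv.symm_apply_apply]
    have := eq_zero_of_sigmaZ_zpow_eq hd h4
    omega
  obtain ⟨l, k, hlk, hne⟩ : ∃ l k : ℤ,
      (sigmaY ^ l * sigmaZ ^ k : PolyYZ F ≃ₐ[F] PolyYZ F) d = d ∧ 0 < l := by
    push Not at htriv
    obtain ⟨l, k, h, hne⟩ := htriv
    have hl : l ≠ 0 := by
      rintro rfl
      refine hne rfl (eq_zero_of_sigmaZ_zpow_eq hd ?_)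
      simpa using h
    rcases hl.lt_or_gt with hl | hl
    · exact ⟨l * -1, k * -1, hfix l k _ h, by omega⟩
    · exact ⟨l, k, h, hl⟩
  obtain ⟨p, hp⟩ := exists_eq_aeval_of_shift_eq hne.ne' hlk
  obtain ⟨β, α, hg, hβ, hα⟩ : ∃ β α : ℤ, IsCoprime α β ∧ 
      l = (l.gcd k : ℤ) * β ∧ -k = (l.gcd k : ℤ) * α := by
    have hg : 0 < l.gcd k := Int.gcd_pos_of_ne_zero_left _ hne.ne'
    obtain ⟨β, α, h, h1, h2⟩ := Int.exists_gcd_one hg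
    refine ⟨β, -α, (Int.isCoprime_iff_gcd_eq_one.2 h).symm.neg_left, ?_, ?_⟩
    · linarith
    · linarith
  set g : ℤ := (l.gcd k : ℤ)
  have hg0 : 0 < g := Int.natCast_pos.2 (Int.gcd_pos_of_ne_zero_left _ hne.ne')
  clear_value g
  have hβ0 : 0 < β := by nlinarith
  -- Since `-k y + l z = g (α y + β z)`, the factor `g` is absorbed into the univariate polynomial.
  refine ⟨α, β, hβ0.ne', ⟨hg, hβ0.le, p.comp (C (g : F) * X), ?_⟩, ?_⟩
  · rw [hp, aeval_comp]
    have h : linForm (-k) l = (g : PolyYZ F) * linForm α β := by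
      rw [hα, hβ, linForm, linForm]
      simp only [zsmul_eq_mul, Int.cast_mul]
      ring
    congr 2
    rw [h]
    simp
  · intro l' k' h'
    have h1 := key l k l' k' hlk h'
    have h2 : α * l' = β * -k' := by
      apply mul_left_cancel₀ hg0.ne'
      rw [← mul_assoc, ← mul_assoc, ← hα, ← hβ]; linarith
    obtain ⟨t, rfl⟩ := hg.symm.dvd_of_dvd_mul_left ⟨_, h2⟩
    refine ⟨t, ?_⟩
    rw [← hzpow]
    have : k' = -α * t := by
      apply mul_left_cancel₀ hβ0.ne'
      linarith
    rw [this]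

end

/-! ### Denominators in `F[y]` modulo differences `τ v - v` -/

section

/-- If `φ v - v` satisfies a condition `M k` at all `k ≠ 0`, where `φ` moves the condition `M k` to
`M (k + 1)` and `v` satisfies almost all of them, then it satisfies `M 0`. -/
theorem map_sub_mem_zero {L : Type*} [AddCommGroup L] (φ : L → L) (M : ℤ → AddSubgroup L)
    (hM : ∀ k v, v ∈ M k → φ v ∈ M (k + 1)) (hM' : ∀ k v, φ v ∈ M (k + 1) → v ∈ M k) (v : L)
    (hfin : {k | v ∉ M k}.Finite) (h : ∀ k ≠ 0, φ v - v ∈ M k) : φ v - v ∈ M 0 := by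
  obtain ⟨N, hN⟩ : ∃ N : ℕ, ∀ k : ℤ, N ≤ |k| → v ∈ M k := by
    obtain ⟨N, hN⟩ := (hfin.image fun k => k.natAbs).bddAbove
    refine ⟨N + 1, fun k hk => by_contra fun hv => ?_⟩
    have h1 : k.natAbs ≤ N := hN ⟨k, hv, rfl⟩
    rw [Int.abs_eq_natAbs] at hk
    omega
  -- For `k ≠ 0`, `v ∈ M k` and `φ v ∈ M k` are equivalent. Membership of `v` thus descends from
  -- large positive indices to `0`, and membership of `φ v` ascends from large negative ones to `0`.
  have hpos (n : ℕ) (hn : n ≤ N) : v ∈ M ((N - n : ℕ) : ℤ) := by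
    induction n with
    | zero => exact hN _ (by simp)
    | succ n ih =>
      apply hM'
      have h1 := (M _).add_mem (h (((N - n : ℕ) : ℤ)) (by omega)) (ih (by omega))
      rw [sub_add_cancel] at h1
      convert h1 using 2
      omega
  have hneg (n : ℕ) (hn : n ≤ N) : φ v ∈ M (-((N - n : ℕ) : ℤ)) := by
    induction n with
    | zero =>
      have h1 := hM _ _ (hN (-((N + 1 : ℕ) : ℤ)) (by rw [abs_neg, Nat.abs_cast]; omega))
      convert h1 using 2
      push_cast; omega
    | succ n ih =>
      have h1 := (M _).sub_mem (ih (by omega)) (h (-((N - n : ℕ) : ℤ)) (by omega))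
      rw [sub_sub_cancel] at h1
      convert hM _ _ h1 using 2
      omega
  have h1 := hpos N le_rfl
  have h2 := hneg N le_rfl
  simp only [tsub_self, Nat.cast_zero, neg_zero] at h1 h2
  exact (M 0).sub_mem h2 h1

variable {F : Type*} [Field F]

/-- The rational functions with a pole of order at most `n` at `p`. -/
def poleSubgroup (p : PolyYZ F) (hp : Prime p) (n : ℕ) : AddSubgroup (RatYZ F) :=
  (localSubring (RatYZ F) p hp).toAddSubgroup.comap (AddMonoidHom.mulLeft (toRat p ^ n))

theorem mem_poleSubgroup {p : PolyYZ F} {hp : Prime p} {n : ℕ} {f : RatYZ F} :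
    f ∈ poleSubgroup p hp n ↔ toRat p ^ n * f ∈ localSubring (RatYZ F) p hp := Iff.rfl

theorem mem_poleSubgroup_of_mem {p : PolyYZ F} {hp : Prime p} {n : ℕ} {f : RatYZ F}
    (hf : f ∈ localSubring (RatYZ F) p hp) : f ∈ poleSubgroup p hp n :=
  (localSubring _ p hp).mul_mem ((localSubring _ p hp).pow_mem (algebraMap_mem_localSubring p) n) hf

theorem ratShift_mem_poleSubgroup (g : PolyYZ F ≃ₐ[F] PolyYZ F) {p q : PolyYZ F} (hp : Prime p)
    (hq : Prime q) (hpq : g p = q) {n : ℕ} {f : RatYZ F} (hf : f ∈ poleSubgroup p hp n) :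
    ratShift F g f ∈ poleSubgroup q hq n := by
  have h := ratShift_mem_localSubring g hp hq hpq hf
  rwa [AddMonoidHom.coe_mulLeft, map_mul, map_pow, ratShift_toRat, hpq] at h

theorem div_mem_poleSubgroup {p : PolyYZ F} (hp : Prime p) (n : ℕ) (u : PolyYZ F) {v : PolyYZ F}
    (hv : v ≠ 0) (h : ¬ p ^ (n + 1) ∣ v) : toRat u / toRat v ∈ poleSubgroup p hp n := by
  by_contra hmem
  have hv0 : toRat v ≠ 0 := by simpa using hv
  refine h (pow_dvd_of_pow_mul_not_mem (L := RatYZ F) (hp := hp) (u := u) n hv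
    (div_mul_cancel₀ _ hv0) fun N hN hN' => hmem ?_)
  rw [mem_poleSubgroup, ← Nat.sub_add_cancel hN, pow_add, mul_assoc]
  exact mem_poleSubgroup_of_mem (n := n - N) hN'

theorem C_dvd_C_iff {p q : F[X]} : (C p : PolyYZ F) ∣ C q ↔ p ∣ q := by
  refine ⟨fun h => ?_, fun ⟨w, hw⟩ => ⟨C w, by rw [hw, C_mul]⟩⟩
  have := (C_dvd_iff_dvd_coeff _ _).1 h 0
  rwa [coeff_C_zero] at this

section Sum

variable {τ : PolyYZ F ≃ₐ[F] PolyYZ F} {b B : F[X]} {a U : PolyYZ F} {v : RatYZ F}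

theorem zpow_prime (τ : PolyYZ F ≃ₐ[F] PolyYZ F) {p : PolyYZ F} (hp : Prime p) (l : ℤ) :
    Prime ((τ ^ l) p) := (MulEquiv.prime_iff (τ ^ l)).2 hp

theorem zpow_dvd_zpow_iff (τ : PolyYZ F ≃ₐ[F] PolyYZ F) {p q : PolyYZ F} {l k : ℤ} :
    (τ ^ l) p ∣ (τ ^ k) q ↔ p ∣ (τ ^ (k - l)) q := by
  rw [← map_dvd_iff (τ ^ l) (a := p), ← AlgEquiv.mul_apply, ← zpow_add, add_sub_cancel]

/-- Distinct `τ`-shifts of prime divisors of a `τ`-free polynomial do not divide each other. -/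
theorem IsTauFree.eq_of_dvd {c p q : PolyYZ F} (hc : IsTauFree τ c) (hp : Prime p) (hpc : p ∣ c)
    (hqc : q ∣ c) {l k : ℤ} (h : (τ ^ l) p ∣ (τ ^ k) q) : l = k := by
  by_contra hlk
  have h1 : (τ ^ (k - l)) q ∣ (τ ^ (k - l)) c := (map_dvd_iff _).2 hqc
  have h2 : IsRelPrime c ((τ ^ (k - l)) c) := hc (k - l) (sub_ne_zero.2 (Ne.symm hlk))
  have h3 : p ∣ (τ ^ (k - l)) c := (zpow_dvd_zpow_iff τ |>.1 h).trans h1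
  have h4 := h2 hpc h3
  exact hp.not_isUnit h4

/-- If no shift of `π ^ (n + 1)` divided `B`, then `U / B` would have poles of order at most `n`
along the `τ`-orbit of `π`. By freeness `a / b` has no pole at the other points of the orbit, so `τ
v - v` would have order at most `n` there, and by `map_sub_mem_zero` also at `π`. Then so would `a /
b`, against coprimality of `a` and `b`. -/
theorem exists_zpow_pow_dvd (hb : b ≠ 0) (hB : B ≠ 0) (hab : IsRelPrime a (C b))
    (hfree : IsTauFree τ (C b))
    (heq : toRat a / toRat (C b) - toRat U / toRat (C B) = ratExt τ v - v)
    {π : F[X]} (hπ : Prime π) {n : ℕ} (hn : π ^ (n + 1) ∣ b) :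
    ∃ l : ℤ, (τ ^ l) (C π) ^ (n + 1) ∣ C B := by
  by_contra! hcon
  have hp : Prime (C π : PolyYZ F) := prime_C_iff.2 hπ
  have hpb : (C π : PolyYZ F) ∣ C b :=
    C_dvd_C_iff.2 ((dvd_pow_self π (Nat.succ_ne_zero n)).trans hn)
  have hb' : (C b : PolyYZ F) ≠ 0 := C_ne_zero.2 hb
  have hB' : (C B : PolyYZ F) ≠ 0 := C_ne_zero.2 hB
  have hU (l : ℤ) : toRat U / toRat (C B) ∈ poleSubgroup _ (zpow_prime τ hp l) n :=
    div_mem_poleSubgroup _ n U hB' (hcon l)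
  have hshift (k : ℤ) : τ ((τ ^ k) (C π)) = (τ ^ (k + 1)) (C π) := by
    rw [add_comm, zpow_add, zpow_one, AlgEquiv.mul_apply]
  have hM (k : ℤ) (f) (hf : f ∈ poleSubgroup _ (zpow_prime τ hp k) n) :
      ratShift F τ f ∈ poleSubgroup _ (zpow_prime τ hp (k + 1)) n :=
    ratShift_mem_poleSubgroup τ _ _ (hshift k) hf
  have hM' (k : ℤ) (f) (hf : ratShift F τ f ∈ poleSubgroup _ (zpow_prime τ hp (k + 1)) n) :
      f ∈ poleSubgroup _ (zpow_prime τ hp k) n := by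
    have h1 : τ⁻¹ ((τ ^ (k + 1)) (C π)) = (τ ^ k) (C π) := by
      rw [← hshift, AlgEquiv.aut_inv, AlgEquiv.symm_apply_apply]
    have h2 := ratShift_mem_poleSubgroup τ⁻¹ _ (zpow_prime τ hp k) h1 hf
    rwa [← RingAut.mul_apply, ← map_mul, inv_mul_cancel, map_one] at h2
  -- Freeness also makes the shifts of `π` pairwise non-associated, so `v` has poles at only
  -- finitely many of them.
  have hfin : {k | v ∉ poleSubgroup _ (zpow_prime τ hp k) n}.Finite :=
    (finite_setOf_not_mem (fun l : ℤ => (τ ^ l) (C π)) (zpow_prime τ hp)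
      (fun l k h => hfree.eq_of_dvd hp hpb hpb h.dvd) v).subset fun l hl hl' =>
        hl (mem_poleSubgroup_of_mem hl')
  have hne (l : ℤ) (hl : l ≠ 0) :
      ratShift F τ v - v ∈ poleSubgroup _ (zpow_prime τ hp l) n := by
    rw [ratShift_apply, ← heq]
    refine (poleSubgroup _ _ n).sub_mem (div_mem_poleSubgroup _ n a hb' fun h => hl ?_) (hU l)
    have h1 : (τ ^ l) (C π) ∣ (τ ^ (0 : ℤ)) (C b) :=
      (dvd_pow_self _ (Nat.succ_ne_zero n)).trans h
    exact hfree.eq_of_dvd hp hpb dvd_rfl h1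
  have h0 := map_sub_mem_zero (ratShift F τ) (fun l => poleSubgroup _ (zpow_prime τ hp l) n)
    hM hM' v hfin hne
  rw [ratShift_apply, ← heq] at h0
  have h1 := (poleSubgroup _ _ n).add_mem h0 (hU 0)
  rw [sub_add_cancel] at h1
  obtain ⟨u, w, hw, h2⟩ := h1
  obtain ⟨b', rfl⟩ := hn
  have h3 : a * w = C π * (u * C b') := by
    apply IsFractionRing.injective (PolyYZ F) (RatYZ F)
    have hπ0 : algebraMap (PolyYZ F) (RatYZ F) (C π) ≠ 0 := by simpa using hπ.ne_zero
    have hb0 : algebraMap (PolyYZ F) (RatYZ F) (C b') ≠ 0 := by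
      simpa using (mul_ne_zero_iff.1 hb).2
    simp only [zpow_zero, AlgEquiv.one_apply, AddMonoidHom.coe_mulLeft, toRat,
      map_mul, map_pow] at h2 ⊢
    rw [← h2]
    field_simp
    ring
  have h4 : C π ∣ a := (hp.dvd_or_dvd ⟨_, h3⟩).resolve_right hw
  exact hp.not_isUnit (hab h4 hpb)

/-- `a / b` with a `τ`-free denominator `b` of positive degree is not of the form `τ v - v`. -/
theorem isUnit_of_eq_sub (hb : b ≠ 0) (hab : IsRelPrime a (C b)) (hfree : IsTauFree τ (C b))
    (heq : toRat a / toRat (C b) = ratExt τ v - v) : IsUnit b := by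
  by_contra hu
  obtain ⟨π, hπ, hdvd⟩ := WfDvdMonoid.exists_irreducible_factor hu hb
  obtain ⟨l, hl⟩ := exists_zpow_pow_dvd (U := 0) (B := 1) (n := 0) hb one_ne_zero hab hfree
    (v := v) (by rw [← heq]; simp) hπ.prime (by simpa using hdvd)
  rw [zero_add, pow_one, C_1] at hl
  exact (zpow_prime τ (prime_C_iff.2 hπ.prime) l).not_isUnit (isUnit_of_dvd_one hl)

/-- Each prime power of `b` has a shift, of equal degree, dividing `B`. By freeness these shifts are
pairwise coprime, whatever the exponents, so their product divides `B`. -/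
theorem natDegree_le_of_sub_eq_sub (hτ : τ ∈ shiftGroup F) (hb : b ≠ 0) (hB : B ≠ 0)
    (hab : IsRelPrime a (C b)) (hfree : IsTauFree τ (C b))
    (heq : toRat a / toRat (C b) - toRat U / toRat (C B) = ratExt τ v - v) :
    b.natDegree ≤ B.natDegree := by
  classical
  set s := UniqueFactorizationMonoid.normalizedFactors b with hs
  have hs1 {π : F[X]} (hπ : π ∈ s) : Prime π :=
    UniqueFactorizationMonoid.prime_of_normalized_factor _ hπ
  have hs2 : Associated (∏ π ∈ s.toFinset, π ^ s.count π) b := by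
    rw [← Finset.prod_multiset_count]
    exact UniqueFactorizationMonoid.prod_normalizedFactors hb
  have h1 : ∀ π ∈ s, ∃ (l : ℤ) (q : F[X]), (τ ^ l) (C π) = C q ∧ q.natDegree = π.natDegree ∧
      q ^ s.count π ∣ B := by
    intro π hπ
    have hc : 0 < s.count π := Multiset.count_pos.2 hπ
    have hpow : π ^ (s.count π - 1 + 1) ∣ b := by
      rw [Nat.sub_add_cancel hc]
      exact (Finset.dvd_prod_of_mem (fun π => π ^ s.count π)
        (Multiset.mem_toFinset.2 hπ)).trans hs2.dvd
    obtain ⟨l, hl⟩ := exists_zpow_pow_dvd hb hB hab hfree heq (hs1 hπ) hpow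
    obtain ⟨q, hq, hdeg⟩ := exists_shift_C (Subgroup.zpow_mem _ hτ l) π
    refine ⟨l, q, hq, hdeg, ?_⟩
    rw [Nat.sub_add_cancel hc, hq, ← C_pow] at hl
    exact C_dvd_C_iff.1 hl
  choose! l q hq hdeg hdvd using h1
  have h2 : ∏ π ∈ s.toFinset, q π ^ s.count π ∣ B := by
    refine Finset.prod_dvd_of_isRelPrime ?_ fun π hπ => hdvd π (Multiset.mem_toFinset.1 hπ)
    intro π hπ π' hπ' hne
    have hπ := Multiset.mem_toFinset.1 hπ
    have hπ' := Multiset.mem_toFinset.1 hπ'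
    have hqi : Irreducible (q π) := by
      have := zpow_prime τ (prime_C_iff.2 (hs1 hπ)) (l π)
      rw [hq π hπ] at this
      exact (prime_C_iff.1 this).irreducible
    refine IsRelPrime.pow (hqi.isRelPrime_iff_not_dvd.2 fun hd => hne ?_)
    have h3 : (τ ^ l π) (C π) ∣ (τ ^ l π') (C π') := by
      rw [hq π hπ, hq π' hπ']; exact C_dvd_C_iff.2 hd
    have hdb {ϖ : F[X]} (h : ϖ ∈ s) : (C ϖ : PolyYZ F) ∣ C b :=
      C_dvd_C_iff.2 (UniqueFactorizationMonoid.dvd_of_mem_normalizedFactors h)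
    have h4 := hfree.eq_of_dvd (prime_C_iff.2 (hs1 hπ)) (hdb hπ) (hdb hπ') h3
    rw [h4, map_dvd_iff] at h3
    have h6 := (hs1 hπ).associated_of_dvd (hs1 hπ') (C_dvd_C_iff.1 h3)
    rw [← UniqueFactorizationMonoid.normalize_normalized_factor π hπ,
      ← UniqueFactorizationMonoid.normalize_normalized_factor π' hπ']
    exact normalize_eq_normalize_iff_associated.2 h6
  have hne (π : F[X]) (hπ : π ∈ s.toFinset) : π ^ s.count π ≠ 0 :=
    pow_ne_zero _ (hs1 (Multiset.mem_toFinset.1 hπ)).ne_zero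
  have hne' (π : F[X]) (hπ : π ∈ s.toFinset) : q π ^ s.count π ≠ 0 :=
    ne_zero_of_dvd_ne_zero hB (hdvd π (Multiset.mem_toFinset.1 hπ))
  calc b.natDegree = (∏ π ∈ s.toFinset, π ^ s.count π).natDegree :=
        (natDegree_eq_of_degree_eq (degree_eq_degree_of_associated hs2)).symm
    _ = (∏ π ∈ s.toFinset, q π ^ s.count π).natDegree := by
        rw [natDegree_prod _ _ hne, natDegree_prod _ _ hne']
        refine Finset.sum_congr rfl fun π hπ => ?_
        rw [natDegree_pow, natDegree_pow, hdeg π (Multiset.mem_toFinset.1 hπ)]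
    _ ≤ B.natDegree := natDegree_le_of_dvd h2 hB

/-- The case of trivial `τ`. -/
theorem natDegree_le_of_sub_eq_zero (hb : b ≠ 0) (hB : B ≠ 0) (hab : IsRelPrime a (C b))
    (heq : toRat a / toRat (C b) - toRat U / toRat (C B) = 0) : b.natDegree ≤ B.natDegree := by
  have hb0 : algebraMap (PolyYZ F) (RatYZ F) (C b) ≠ 0 := by simpa using hb
  have hB0 : algebraMap (PolyYZ F) (RatYZ F) (C B) ≠ 0 := by simpa using hB
  have h1 : a * C B = C b * U := by
    apply IsFractionRing.injective (PolyYZ F) (RatYZ F)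
    rw [sub_eq_zero, div_eq_div_iff hb0 hB0] at heq
    rw [map_mul, map_mul]
    exact heq.trans (mul_comm _ _)
  have h2 : C b ∣ C B := hab.symm.dvd_of_dvd_mul_left ⟨_, h1⟩
  exact natDegree_le_of_dvd (C_dvd_C_iff.1 h2) hB

end Sum

end

/-! ### The subgroup `W` and the residue at a shift orbit -/

section

variable {F : Type*} [Field F]

/-- `σ_z` fixes `F[y]`, so the freeness required of a remainder fraction is freeness for `σ_y^β
σ_z^(-α)`, whose powers contain the stabilizer. -/
theorem IsTauFree.mul_zpow {α β : ℤ} {b : F[X]} (h : IsTauFree (sigmaY ^ β) (C b)) :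
    IsTauFree (sigmaY ^ β * sigmaZ ^ α) (C b) := by
  intro l hl
  have h1 := h l hl
  have h2 : ((sigmaY ^ β : PolyYZ F ≃ₐ[F] PolyYZ F) ^ l) (C b) =
      ((sigmaY ^ β * sigmaZ ^ α : PolyYZ F ≃ₐ[F] PolyYZ F) ^ l) (C b) := by
    rw [((commute_sigma (F := F)).zpow_zpow β α).mul_zpow, ← zpow_mul, ← zpow_mul, shift_C,
      sigmaY_zpow_apply, map_C]
    rfl
  rwa [h2] at h1

/-- The coefficients of `a` in powers of the linear form have degree below `deg_y b = 0`, so they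
vanish. -/
theorem IsRemainderFraction.eq_zero_of_isUnit {a d : PolyYZ F} {b : F[X]} {j : ℕ} {α β : ℤ}
    (h : IsRemainderFraction a b d j) (hd : IsIntegerLinear α β d) (hb : IsUnit b) : a = 0 := by
  obtain ⟨c, hc, hdeg⟩ := h.numerator α β hd
  rw [hc]
  refine Finset.sum_eq_zero fun i hi => ?_
  have h1 := hdeg i hi
  rw [degree_eq_zero_of_isUnit hb, Nat.WithBot.lt_zero_iff, degree_eq_bot] at h1
  rw [h1, C_0, zero_mul]

/-- A group of elements vanishing in the coinvariants of the stabilizer of `d`, which detects the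
denominators of remainder fractions. -/
theorem IsMonicIrred.exists_addSubgroup [CharZero F] {d : PolyYZ F} (hd : IsMonicIrred d) :
    ∃ W : AddSubgroup (RatYZ F),
      (∀ s ∈ shiftGroup F, s d = d → ∀ v, ratShift F s v - v ∈ W) ∧
      ∀ (a : PolyYZ F) (b : F[X]) (j : ℕ), IsRemainderFraction a b d j → IsRelPrime a (C b) →
        (∀ (U : PolyYZ F) (B : F[X]), B ≠ 0 → toRat a / toRat (C b) - toRat U / toRat (C B) ∈ W →
          b.natDegree ≤ B.natDegree) ∧
        (toRat a / toRat (C b) ∈ W → a = 0) := by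
  rcases shift_stabilizer hd.2.2 with h | ⟨α, β, -, hlin, h⟩
  · refine ⟨⊥, ?_, fun a b j hfrac hab => ⟨fun U B hB hW => ?_, fun hW => ?_⟩⟩
    · rintro _ ⟨l, k, rfl⟩ hs v
      obtain ⟨rfl, rfl⟩ := h l k hs
      rw [zpow_zero, zpow_zero, mul_one, map_one, RingAut.one_apply, sub_self]
      exact AddSubgroup.zero_mem _
    · exact natDegree_le_of_sub_eq_zero hfrac.den_ne_zero hB hab (AddSubgroup.mem_bot.1 hW)
    · have hb : toRat (C b) ≠ 0 := by simpa using hfrac.den_ne_zero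
      have h1 := (div_eq_zero_iff.1 (AddSubgroup.mem_bot.1 hW)).resolve_right hb
      exact (IsFractionRing.to_map_eq_zero_iff).1 h1
  · set τ : PolyYZ F ≃ₐ[F] PolyYZ F := sigmaY ^ β * sigmaZ ^ (-α) with hτ
    let δ : RatYZ F →+ RatYZ F :=
      (ratShift F τ).toRingHom.toAddMonoidHom - AddMonoidHom.id (RatYZ F)
    have hδ (v : RatYZ F) : δ v = ratShift F τ v - v := rfl
    have hmem {f : RatYZ F} : f ∈ δ.range ↔ ∃ v, ratShift F τ v - v = f := Iff.rfl
    refine ⟨δ.range, ?_, fun a b j hfrac hab => ⟨fun U B hB hW => ?_, fun hW => ?_⟩⟩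
    · rintro _ ⟨l, k, rfl⟩ hs
      obtain ⟨t, ht⟩ := h l k hs
      rw [ht]
      -- The automorphisms acting trivially modulo the image of `τ - 1` form a group; it contains
      -- `τ`, hence its powers.
      let H : Subgroup (PolyYZ F ≃ₐ[F] PolyYZ F) :=
        { carrier := {g | ∀ v, ratShift F g v - v ∈ δ.range}
          one_mem' := fun v => by
            rw [map_one, RingAut.one_apply, sub_self]
            exact AddSubgroup.zero_mem _
          mul_mem' := fun {g g'} hg hg' v => by
            rw [map_mul, RingAut.mul_apply]
            simpa using AddSubgroup.add_mem _ (hg (ratShift F g' v)) (hg' v)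
          inv_mem' := fun {g} hg v => by
            have h1 := AddSubgroup.neg_mem _ (hg (ratShift F g⁻¹ v))
            rwa [← RingAut.mul_apply, ← map_mul, mul_inv_cancel, map_one, RingAut.one_apply,
              neg_sub] at h1 }
      have hH : τ ∈ H := fun v => ⟨v, rfl⟩
      exact H.zpow_mem hH t
    · obtain ⟨v, hv⟩ := hmem.1 hW
      exact natDegree_le_of_sub_eq_sub ⟨β, -α, rfl⟩ hfrac.den_ne_zero hB hab
        (hfrac.denominator α β hlin).mul_zpow hv.symm
    · obtain ⟨v, hv⟩ := hmem.1 hW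
      exact hfrac.eq_zero_of_isUnit hlin (isUnit_of_eq_sub hfrac.den_ne_zero hab
        (hfrac.denominator α β hlin).mul_zpow hv.symm)

section Residue

variable {d : PolyYZ F} (hd : IsMonicIrred d) (W : AddSubgroup (RatYZ F))

/-- The residue at the orbit of `d`, with values modulo `W`. -/
abbrev orbitResidue (j : ℕ) : RatYZ F →+ RatYZ F ⧸ W := (orbitExpansion hd).residue W j

theorem orbitResidue_eq_zero_of_mem (j : ℕ) {f : RatYZ F}
    (h : ∀ x, ∀ hx : IsMonicIrred x, ShiftEquiv x d → f ∈ hx.localExpansion.O) :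
    orbitResidue hd W j f = 0 :=
  OrbitExpansion.residue_eq_zero _ _ _ _ fun x =>
    LocalExpansion.coeff_eq_zero_of_mem _
      (h x.1 ((mem_orbit_iff.1 x.2).isMonicIrred hd) (mem_orbit_iff.1 x.2)) j

theorem orbitResidue_simpleFrac_of_not_shiftEquiv (j : ℕ) {a e : PolyYZ F} {b : F[X]} {i : ℕ}
    (he : IsMonicIrred e) (hb : b ≠ 0) (hed : ¬ ShiftEquiv e d) :
    orbitResidue hd W j (simpleFrac a b e i) = 0 :=
  orbitResidue_eq_zero_of_mem hd W j fun _ hx hxd =>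
    hx.simpleFrac_mem he (fun h => hed (h ▸ hxd)) a hb i

theorem orbitResidue_simpleFrac (j : ℕ) {a e : PolyYZ F} {b : F[X]} {i : ℕ}
    (he : IsMonicIrred e) (hb : b ≠ 0) (ha : a.degree < e.degree) (hed : ShiftEquiv e d) :
    orbitResidue hd W j (simpleFrac a b e (i + 1)) =
      QuotientAddGroup.mk' W (ratShift F ((orbitExpansion hd).rep ⟨e, mem_orbit_iff.2 hed⟩)⁻¹.1
        (if i = j then toRat a / toRat (C b) else 0)) := by
  rw [orbitResidue, OrbitExpansion.residue_eq_single _ _ _ _ ⟨e, mem_orbit_iff.2 hed⟩]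
  · rw [← he.coeff_simpleFrac_self hb ha]; rfl
  · intro y hy
    exact ((mem_orbit_iff.1 y.2).isMonicIrred hd).coeff_simpleFrac_of_ne he (fun h => hy (Subtype.ext h.symm)) a hb _ _

theorem orbitResidue_simpleFrac_of_ne (j : ℕ) {a e : PolyYZ F} {b : F[X]} {i : ℕ}
    (he : IsMonicIrred e) (hb : b ≠ 0) (ha : a.degree < e.degree) (hij : i ≠ j) :
    orbitResidue hd W j (simpleFrac a b e (i + 1)) = 0 := by
  by_cases hed : ShiftEquiv e d
  · rw [orbitResidue_simpleFrac hd W j he hb ha hed, if_neg hij, map_zero, map_zero]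
  · exact orbitResidue_simpleFrac_of_not_shiftEquiv hd W j he hb hed

theorem exists_orbitResidue_simpleFrac (j : ℕ) {a e : PolyYZ F} {b : F[X]}
    (he : IsMonicIrred e) (hb : b ≠ 0) (ha : a.degree < e.degree) (hed : ShiftEquiv e d) :
    ∃ (a' : PolyYZ F) (b' : F[X]), b' ≠ 0 ∧ b'.natDegree = b.natDegree ∧
      orbitResidue hd W j (simpleFrac a b e (j + 1)) =
        QuotientAddGroup.mk' W (toRat a' / toRat (C b')) := by
  set g := ((orbitExpansion hd).rep ⟨e, mem_orbit_iff.2 hed⟩)⁻¹ with hg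
  obtain ⟨c, hc, hdeg⟩ := exists_shift_C g.2 b
  refine ⟨g.1 a, c, ?_, hdeg, ?_⟩
  · rintro rfl
    exact hb (by simpa using hc)
  · rw [orbitResidue_simpleFrac hd W j he hb ha hed, if_pos rfl, map_div₀, ratShift_toRat,
      ratShift_toRat, ← hg, hc]

variable {W} (hW : ∀ s ∈ shiftGroup F, s d = d → ∀ v, ratShift F s v - v ∈ W)

include hW

/-- The shift chosen to reach `d` from itself need not be the identity, but it stabilizes `d`; the
digit is recovered modulo `W`. -/
theorem orbitResidue_simpleFrac_self (j : ℕ) {a : PolyYZ F} {b : F[X]} (hb : b ≠ 0)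
    (ha : a.degree < d.degree) :
    orbitResidue hd W j (simpleFrac a b d (j + 1)) =
      QuotientAddGroup.mk' W (toRat a / toRat (C b)) := by
  rw [orbitResidue_simpleFrac hd W j hd hb ha (ShiftEquiv.refl d), if_pos rfl, ← sub_eq_zero,
    ← map_sub, ← AddMonoidHom.mem_ker, QuotientAddGroup.ker_mk']
  refine hW _ (Subtype.property _) ?_ _
  have h := (orbitExpansion hd).rep_smul ⟨d, MulAction.mem_orbit_self d⟩
  rw [eq_comm, ← inv_smul_eq_iff] at h
  exact congrArg Subtype.val h

theorem orbitResidue_eq_of_isSummable (j : ℕ) {r r' : RatYZ F} (h : IsSummable (r' - r)) :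
    orbitResidue hd W j r' = orbitResidue hd W j r := by
  have hW' : ∀ s : shiftGroup F, s • (orbitExpansion hd).x₀ = (orbitExpansion hd).x₀ →
      ∀ v, (orbitExpansion hd).φ s v - v ∈ W :=
    fun s hs v => hW s.1 s.2 (congrArg Subtype.val hs) v
  have key (g : shiftGroup F) (f : RatYZ F) :
      orbitResidue hd W j (ratExt g.1 f - f) = 0 := by
    rw [map_sub, sub_eq_zero]
    exact (orbitExpansion hd).residue_map W hW' j g f
  obtain ⟨g, h, hgh⟩ := h
  rw [← sub_eq_zero, ← map_sub, hgh, map_add, key ⟨sigmaY, 1, 0, by simp⟩,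
    key ⟨sigmaZ, 0, 1, by simp⟩, add_zero]

end Residue

/-- The common denominator is the plain product, without cancellation, so that degrees add up
exactly. -/
theorem exists_sum_eq_mk {ι : Type*} (W : AddSubgroup (RatYZ F)) (s : Finset ι)
    (x : ι → RatYZ F ⧸ W) (N : ι → ℕ)
    (h : ∀ i ∈ s, ∃ (a : PolyYZ F) (b : F[X]), b ≠ 0 ∧ b.natDegree = N i ∧
      x i = QuotientAddGroup.mk' W (toRat a / toRat (C b))) :
    ∃ (a : PolyYZ F) (b : F[X]), b ≠ 0 ∧ b.natDegree = ∑ i ∈ s, N i ∧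
      ∑ i ∈ s, x i = QuotientAddGroup.mk' W (toRat a / toRat (C b)) := by
  classical
  induction s using Finset.induction_on with
  | empty => exact ⟨0, 1, one_ne_zero, by simp, by simp⟩
  | insert i s hi ih =>
    obtain ⟨a, b, hb, hdeg, hx⟩ := ih fun k hk => h k (Finset.mem_insert_of_mem hk)
    obtain ⟨a', b', hb', hdeg', hx'⟩ := h i (Finset.mem_insert_self i s)
    have h0 : algebraMap (PolyYZ F) (RatYZ F) (C b) ≠ 0 := by simpa using hb
    have h0' : algebraMap (PolyYZ F) (RatYZ F) (C b') ≠ 0 := by simpa using hb'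
    refine ⟨a' * C b + a * C b', b' * b, mul_ne_zero hb' hb, ?_, ?_⟩
    · rw [natDegree_mul hb' hb, Finset.sum_insert hi, hdeg, hdeg']
    · rw [Finset.sum_insert hi, hx, hx', ← map_add]
      congr 1
      simp only [toRat, map_mul, map_add]
      field_simp

end

/-! ### Residues of the remainder form and of the partial fraction form -/

section

variable {F : Type*} [Field F]

theorem mem_shiftIdx {m : ℕ} {d : Fin m → PolyYZ F} {e : PolyYZ F} {i : Fin m} :
    i ∈ shiftIdx d e ↔ ShiftEquiv (d i) e := by
  simp [shiftIdx]

theorem denom_dvd_of_mul_eq {f : RatYZ F} {u v : PolyYZ F} (h : f * toRat v = toRat u) :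
    denom f ∣ v := by
  have h0 := mul_denom f
  have h2 := isRelPrime_num_denom f
  generalize IsFractionRing.num (PolyYZ F) f = w at h0 h2
  generalize denom f = D at h0 h2
  have h1 : w * v = D * u := by
    apply IsFractionRing.injective (PolyYZ F) (RatYZ F)
    change f * algebraMap _ _ D = algebraMap _ _ w at h0
    change f * algebraMap _ _ v = algebraMap _ _ u at h
    rw [map_mul, map_mul, ← h0, ← h]; ring
  exact h2.symm.dvd_of_dvd_mul_left ⟨_, h1⟩

theorem IsReducedForm.isRelPrime {m : ℕ} {n : Fin m → ℕ} {a : Fin m → ℕ → PolyYZ F}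
    {b : Fin m → ℕ → F[X]} {d : Fin m → PolyYZ F} (hred : IsReducedForm m n a b d) {i : Fin m} {j : ℕ}
    (hj : j ∈ Finset.Icc 1 (n i)) : IsRelPrime (a i j) (C (b i j)) := by
  by_cases ha : a i j = 0
  · exact ((hred.isUnit_of_zero i j hj ha).map (C : F[X] →+* PolyYZ F)).isRelPrime_right
  · exact (hred.relPrime i j hj ha).of_mul_right_left

namespace IsRemainderForm

variable {r : RatYZ F} {m : ℕ} {n : Fin m → ℕ} {a : Fin m → ℕ → PolyYZ F}
  {b : Fin m → ℕ → F[X]} {d : Fin m → PolyYZ F} (h : IsRemainderForm r m n a b d)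

include h

/-- If `n i = 0`, no summand has a pole at `d i`, although `d i` divides the denominator of `r`. -/
theorem one_le (i : Fin m) : 1 ≤ n i := by
  by_contra hn
  refine (h.monicIrred i).not_mem_of_dvd_denom (h.dvd_denom i) ?_
  generalize h.monicIrred i = hi
  rw [h.eq_sum]
  refine Subring.sum_mem _ fun k _ => Subring.sum_mem _ fun j hj => ?_
  refine hi.simpleFrac_mem (h.monicIrred k) (fun hki => hn ?_) _
    (h.frac k j hj).den_ne_zero j
  have hik : i = k := by
    by_contra hik
    exact h.inequiv i k hik (hki ▸ ShiftEquiv.refl _)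
  rw [Finset.mem_Icc] at hj
  subst hik
  exact hj.1.trans hj.2

/-- The product of all `b i j` and all `d i ^ n i` is a common denominator, and the factors `b i j`
contribute nothing to the degree in `z`. -/
theorem natDegree_denom_le : (denom r).natDegree ≤ ∑ i, n i * (d i).natDegree := by
  set B : F[X] := ∏ i, ∏ j ∈ Finset.Icc 1 (n i), b i j with hB
  have hB0 : B ≠ 0 := Finset.prod_ne_zero_iff.2 fun i _ => Finset.prod_ne_zero_iff.2
    fun j hj => (h.frac i j hj).den_ne_zero
  have hd0 : ∏ i, d i ^ n i ≠ 0 :=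
    Finset.prod_ne_zero_iff.2 fun i _ => pow_ne_zero _ (h.monicIrred i).ne_zero
  have hmem : r * toRat (C B * ∏ i, d i ^ n i) ∈ (algebraMap (PolyYZ F) (RatYZ F)).range := by
    rw [h.eq_sum, Finset.sum_mul]
    refine Subring.sum_mem _ fun i _ => ?_
    rw [Finset.sum_mul]
    refine Subring.sum_mem _ fun j hj => ?_
    have h1 : C (b i j) * d i ^ j ∣ C B * ∏ i, d i ^ n i := by
      refine mul_dvd_mul (C_dvd_C_iff.2 ?_) ((pow_dvd_pow _ (Finset.mem_Icc.1 hj).2).trans ?_)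
      · exact (Finset.dvd_prod_of_mem (fun j => b i j) hj).trans
          (Finset.dvd_prod_of_mem (fun i => ∏ j ∈ Finset.Icc 1 (n i), b i j) (Finset.mem_univ i))
      · exact Finset.dvd_prod_of_mem (fun i => d i ^ n i) (Finset.mem_univ i)
    obtain ⟨q, hq⟩ := h1
    refine ⟨a i j * q, ?_⟩
    have hb : toRat (C (b i j)) ≠ 0 := by simpa using (h.frac i j hj).den_ne_zero
    have hd : toRat (d i) ≠ 0 := by simpa using (h.monicIrred i).ne_zero
    rw [hq, simpleFrac]
    simp only [toRat, map_mul, map_pow] at hb hd ⊢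
    field_simp
  obtain ⟨u, hu⟩ := hmem
  calc (denom r).natDegree ≤ (C B * ∏ i, d i ^ n i).natDegree :=
        natDegree_le_of_dvd (denom_dvd_of_mul_eq hu.symm) (mul_ne_zero (C_ne_zero.2 hB0) hd0)
    _ = ∑ i, n i * (d i).natDegree := by
        rw [natDegree_C_mul hB0, natDegree_prod _ _ (Finset.prod_ne_zero_iff.1 hd0)]
        simp only [natDegree_pow]

theorem orbitResidue_eq {W : AddSubgroup (RatYZ F)} (i : Fin m)
    (hW : ∀ s ∈ shiftGroup F, s (d i) = d i → ∀ v, ratShift F s v - v ∈ W) {j : ℕ}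
    (hj : j + 1 ∈ Finset.Icc 1 (n i)) :
    orbitResidue (h.monicIrred i) W j r =
      QuotientAddGroup.mk' W (toRat (a i (j + 1)) / toRat (C (b i (j + 1)))) := by
  generalize h.monicIrred i = hi
  rw [h.eq_sum, map_sum, Finset.sum_eq_single i, map_sum, Finset.sum_eq_single (j + 1)]
  · exact orbitResidue_simpleFrac_self _ hW j (h.frac i _ hj).den_ne_zero (h.frac i _ hj).degree_lt
  · intro k hk hkj
    obtain ⟨k, rfl⟩ := Nat.exists_eq_add_of_le' (Finset.mem_Icc.1 hk).1
    exact orbitResidue_simpleFrac_of_ne _ _ _ (h.monicIrred i) (h.frac i _ hk).den_ne_zero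
      (h.frac i _ hk).degree_lt (by omega)
  · exact fun hj' => absurd hj hj'
  · intro k _ hki
    rw [map_sum]
    exact Finset.sum_eq_zero fun l hl => orbitResidue_simpleFrac_of_not_shiftEquiv _ _ _
      (h.monicIrred k) (h.frac k l hl).den_ne_zero (h.inequiv k i hki)
  · exact fun hi => absurd (Finset.mem_univ i) hi

end IsRemainderForm

namespace IsPartialFractionForm

variable {r p : RatYZ F} {m : ℕ} {n : Fin m → ℕ} {a : Fin m → ℕ → PolyYZ F}
  {b : Fin m → ℕ → F[X]} {d : Fin m → PolyYZ F} (h : IsPartialFractionForm r p m n a b d)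

include h

/-- The `d i` may repeat, so several fractions can contribute to one digit; a nonzero digit still
needs at least one of them. -/
theorem exists_of_coeff_ne_zero {x : PolyYZ F} (hx : IsMonicIrred x) {j : ℕ}
    (hj : hx.localExpansion.coeff j r ≠ 0) : ∃ i, d i = x ∧ j + 1 ≤ n i := by
  by_contra! hcon
  refine hj ?_
  rw [h.eq_sum, map_add, LocalExpansion.coeff_eq_zero_of_mem _ (hx.mem_of_isPolyInZ h.polyPart),
    zero_add, map_sum]
  refine Finset.sum_eq_zero fun i _ => ?_
  rw [map_sum]
  refine Finset.sum_eq_zero fun k hk => ?_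
  by_cases hi : d i = x
  · have hlt := hcon i hi
    obtain ⟨h1, h2⟩ := Finset.mem_Icc.1 hk
    have hb := h.den_ne_zero i k hk
    have ha := h.degree_lt i k hk
    obtain ⟨k, rfl⟩ := Nat.exists_eq_add_of_le' h1
    subst hi
    rw [hx.coeff_simpleFrac_self hb ha, if_neg (by omega)]
  · exact hx.coeff_simpleFrac_of_ne (h.monicIrred i) hi _ (h.den_ne_zero i k hk) _ _

theorem exists_orbitResidue_eq {e : PolyYZ F} (he : IsMonicIrred e) (W : AddSubgroup (RatYZ F))
    (j : ℕ) : ∃ (U : PolyYZ F) (B : F[X]), B ≠ 0 ∧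
      B.natDegree = ∑ i ∈ shiftIdx d e with j + 1 ≤ n i, (b i (j + 1)).natDegree ∧
      orbitResidue he W j r = QuotientAddGroup.mk' W (toRat U / toRat (C B)) := by
  have hsum : orbitResidue he W j r = ∑ i ∈ shiftIdx d e with j + 1 ≤ n i,
      orbitResidue he W j (simpleFrac (a i (j + 1)) (b i (j + 1)) (d i) (j + 1)) := by
    conv_lhs => rw [h.eq_sum]
    rw [map_add, orbitResidue_eq_zero_of_mem he W j
      (fun x hx _ => hx.mem_of_isPolyInZ h.polyPart), zero_add, map_sum]
    have hz (i : Fin m) (k : ℕ) (hk : k ∈ Finset.Icc 1 (n i)) (hkj : k ≠ j + 1) :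
        orbitResidue he W j (simpleFrac (a i k) (b i k) (d i) k) = 0 := by
      have hb := h.den_ne_zero i k hk
      have ha := h.degree_lt i k hk
      obtain ⟨k, rfl⟩ := Nat.exists_eq_add_of_le' (Finset.mem_Icc.1 hk).1
      exact orbitResidue_simpleFrac_of_ne he W j (h.monicIrred i) hb ha (by omega)
    rw [← Finset.sum_subset (Finset.subset_univ ((shiftIdx d e).filter fun i => j + 1 ≤ n i))]
    · refine Finset.sum_congr rfl fun i hi => ?_
      rw [map_sum]
      refine Finset.sum_eq_single _ (hz i) fun hj => absurd ?_ hj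
      exact Finset.mem_Icc.2 ⟨by omega, (Finset.mem_filter.1 hi).2⟩
    · intro i _ hi
      rw [map_sum]
      refine Finset.sum_eq_zero fun k hk => ?_
      by_cases hkj : k = j + 1
      · refine orbitResidue_simpleFrac_of_not_shiftEquiv he W j (h.monicIrred i)
          (h.den_ne_zero i k hk) fun hs => hi ?_
        rw [Finset.mem_filter, mem_shiftIdx]
        exact ⟨hs, hkj ▸ (Finset.mem_Icc.1 hk).2⟩
      · exact hz i k hk hkj
  rw [hsum]
  refine exists_sum_eq_mk W _ _ _ fun i hi => ?_
  obtain ⟨hi, hj⟩ := Finset.mem_filter.1 hi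
  have hmem : j + 1 ∈ Finset.Icc 1 (n i) := Finset.mem_Icc.2 ⟨by omega, hj⟩
  exact exists_orbitResidue_simpleFrac he W j (h.monicIrred i) (h.den_ne_zero i _ hmem)
    (h.degree_lt i _ hmem) (mem_shiftIdx.1 hi)

end IsPartialFractionForm

/-! ### Comparison of `r` and `r'` -/

section Main

variable {r : RatYZ F} {m : ℕ} {n : Fin m → ℕ} {a : Fin m → ℕ → PolyYZ F}
  {b : Fin m → ℕ → F[X]} {d : Fin m → PolyYZ F}
  (hform : IsRemainderForm r m n a b d) (hred : IsReducedForm m n a b d)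
  {r' : RatYZ F} (hsum : IsSummable (r' - r))

include hform hred hsum

/-- Some shift of `d i` is a pole of `r'` of the same order as `d i` has in `r`. -/
theorem exists_shiftEquiv_coeff_ne_zero [CharZero F] (i : Fin m) :
    ∃ x, ∃ hx : IsMonicIrred x, ShiftEquiv x (d i) ∧
      hx.localExpansion.coeff (n i - 1) r' ≠ 0 := by
  obtain ⟨W, hW, hWd⟩ := (hform.monicIrred i).exists_addSubgroup
  by_contra! hcon
  have hn := hform.one_le i
  have hmem : n i - 1 + 1 ∈ Finset.Icc 1 (n i) := Finset.mem_Icc.2 ⟨by omega, by omega⟩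
  have h1 : orbitResidue (hform.monicIrred i) W (n i - 1) r' = 0 :=
    OrbitExpansion.residue_eq_zero _ _ _ _ fun x =>
      hcon x.1 ((mem_orbit_iff.1 x.2).isMonicIrred (hform.monicIrred i)) (mem_orbit_iff.1 x.2)
  rw [orbitResidue_eq_of_isSummable _ hW _ hsum, hform.orbitResidue_eq i hW hmem,
    ← AddMonoidHom.mem_ker, QuotientAddGroup.ker_mk'] at h1
  have h2 := (hWd _ _ _ (hform.frac i _ hmem) (hred.isRelPrime hmem)).2 h1
  rw [Nat.sub_add_cancel hn] at h2
  exact hred.top_ne_zero i hn h2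

theorem natDegree_le_sum [CharZero F] {p' : RatYZ F} {m' : ℕ} {n' : Fin m' → ℕ}
    {a' : Fin m' → ℕ → PolyYZ F} {b' : Fin m' → ℕ → F[X]} {d' : Fin m' → PolyYZ F}
    (hform' : IsPartialFractionForm r' p' m' n' a' b' d') (i : Fin m) {j : ℕ}
    (hj : j ∈ Finset.Icc 1 (n i)) :
    (b i j).natDegree ≤ ∑ i' ∈ shiftIdx d' (d i) with j ≤ n' i', (b' i' j).natDegree := by
  obtain ⟨W, hW, hWd⟩ := (hform.monicIrred i).exists_addSubgroup
  obtain ⟨j, rfl⟩ := Nat.exists_eq_add_of_le' (Finset.mem_Icc.1 hj).1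
  obtain ⟨U, B, hB, hdeg, hres⟩ := hform'.exists_orbitResidue_eq (hform.monicIrred i) W j
  rw [orbitResidue_eq_of_isSummable _ hW _ hsum, hform.orbitResidue_eq i hW hj, ← sub_eq_zero,
    ← map_sub, ← AddMonoidHom.mem_ker, QuotientAddGroup.ker_mk'] at hres
  rw [← hdeg]
  exact (hWd _ _ _ (hform.frac i _ hj) (hred.isRelPrime hj)).1 U B hB hres

/-- The denominator of `r'` is divisible by `x i ^ n i` for some shift `x i` of each `d i`. These
powers are pairwise coprime because the `d i` are inequivalent, and shifts preserve the degree in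
`z`. -/
theorem natDegree_denom_le_natDegree_denom [CharZero F] :
    (denom r).natDegree ≤ (denom r').natDegree := by
  choose x hx hxd hcoeff using exists_shiftEquiv_coeff_ne_zero hform hred hsum
  have hdvd : ∏ i, x i ^ n i ∣ denom r' := by
    refine Finset.prod_dvd_of_isRelPrime ?_ fun i _ => ?_
    · intro i _ k _ hik
      refine IsRelPrime.pow ((hx i).2.1.isRelPrime_iff_not_dvd.2 fun hd => ?_)
      have h1 := (hx i).eq_of_dvd (hx k) hd
      exact hform.inequiv i k hik ((hxd i).symm.trans (h1 ▸ hxd k))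
    · have h1 := (hx i).pow_dvd_of_coeff_ne_zero (hcoeff i)
      rwa [Nat.sub_add_cancel (hform.one_le i)] at h1
  calc (denom r).natDegree ≤ ∑ i, n i * (d i).natDegree := hform.natDegree_denom_le
    _ = (∏ i, x i ^ n i).natDegree := by
        rw [natDegree_prod _ _ fun i _ => pow_ne_zero _ (hx i).ne_zero]
        refine Finset.sum_congr rfl fun i _ => ?_
        rw [natDegree_pow, natDegree_eq_of_degree_eq (hxd i).degree_eq]
    _ ≤ (denom r').natDegree := natDegree_le_of_dvd hdvd (denom_ne_zero r')

end Main

end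

end Remainders

end

theorem mainTheorem4 {K : Type*} [Field K] [CharZero K]
    (r : Remainders.RatYZ (RatFunc K)) (hr : r ≠ 0)
    (m : ℕ) (n : Fin m → ℕ) (a : Fin m → ℕ → Remainders.PolyYZ (RatFunc K))
    (b : Fin m → ℕ → Polynomial (RatFunc K)) (d : Fin m → Remainders.PolyYZ (RatFunc K))
    (hform : Remainders.IsRemainderForm r m n a b d)
    (hred : Remainders.IsReducedForm m n a b d)
    (r' : Remainders.RatYZ (RatFunc K)) (hsum : Remainders.IsSummable (r' - r))
    (p' : Remainders.RatYZ (RatFunc K))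
    (m' : ℕ) (n' : Fin m' → ℕ) (a' : Fin m' → ℕ → Remainders.PolyYZ (RatFunc K))
    (b' : Fin m' → ℕ → Polynomial (RatFunc K)) (d' : Fin m' → Remainders.PolyYZ (RatFunc K))
    (hform' : Remainders.IsPartialFractionForm r' p' m' n' a' b' d') :
    (∀ i, (Remainders.shiftIdx d' (d i)).Nonempty) ∧
    m ≤ m' ∧
    (∀ i, ∃ i' ∈ Remainders.shiftIdx d' (d i), n i ≤ n' i') ∧
    (∀ i, ∀ j ∈ Finset.Icc 1 (n i),
      (b i j).natDegree ≤
        ∑ i' ∈ Remainders.shiftIdx d' (d i) with j ≤ n' i', (b' i' j).natDegree) ∧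
    (Remainders.denom r).natDegree ≤ (Remainders.denom r').natDegree := by
  obtain h := Remainders.exists_shiftEquiv_coeff_ne_zero hform hred hsum
  choose x hx hxd hcoeff using h
  have h1 (i : Fin m) : ∃ i', d' i' = x i ∧ n i ≤ n' i' := by
    have h := hform'.exists_of_coeff_ne_zero (hx i) (hcoeff i)
    rwa [Nat.sub_add_cancel (hform.one_le i)] at h
  choose f hf hn using h1
  have hmem (i : Fin m) : f i ∈ Remainders.shiftIdx d' (d i) :=
    Remainders.mem_shiftIdx.2 (hf i ▸ hxd i)
  refine ⟨fun i => ⟨f i, hmem i⟩, ?_, fun i => ⟨f i, hmem i, hn i⟩,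
    fun i j hj => Remainders.natDegree_le_sum hform hred hsum hform' i hj,
    Remainders.natDegree_denom_le_natDegree_denom hform hred hsum⟩
  -- An index `i'` shared by `i` and `k` would make `d i` and `d k` both shift equivalent to `d'
  -- i'`.
  have hinj : Function.Injective f := fun i k hik => by
    by_contra hne
    refine hform.inequiv i k hne ((hxd i).symm.trans ?_)
    rw [← hf i, hik, hf k]
    exact hxd k
  simpa using Fintype.card_le_of_injective f hinj
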